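/- **Theorem (zero elliptic residue local model).** Let $D=\{x_1=x_2=0\}\subset\mathbb{R}^4$, and let $\mathcal{A}_{|D|}$ be the elliptic tangent bundle, with global frame $r\partial_r=x_1\partial_1+x_2\partial_2$, $\partial_\theta=x_1\partial_2-x_2\partial_1$, $\partial_3$, $\partial_4$, dual coframe $d\log r, d\theta, dx_3, dx_4$ and anchor $\rho:\mathcal{A}_{|D|}\to T\mathbb{R}^4$. Let $\omega=d\log r\wedge dx_3+d\theta\wedge dx_4$ be the elliptic symplectic form with zero elliptic residue and let $\pi$ be the associated elliptic Poisson structure, $\pi^\sharp=\rho\circ(\omega^\flat)^{-1}\circ\rho^*$, i.e. $\pi=r\partial_r\wedge\partial_3+\partial_\theta\wedge\partial_4$ (with the convention $\pi^\sharp\alpha=\pi(\cdot,\alpha)$). Identify $\mathbb{R}^4\cong\mathbb{C}^2$ by $(x_1,x_2,x_3,x_4)\mapsto(x_1+ix_2,\;x_3-ix_4)$, and let $\mathcal{A}=(T^*\mathbb{C}^2,\pi^\sharp,[\cdot,\cdot]_\pi)$ be the cotangent Lie algebroid, $[\alpha,\beta]_\pi=L_{\pi^\sharp\alpha}\beta-L_{\pi^\sharp\beta}\alpha-d\langle\beta,\pi^\sharp\alpha\rangle$.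 Let $\beta:\widetilde{\mathbb{C}^4}\to\mathbb{C}^4=\mathbb{C}^2\times\mathbb{C}^2$ be the complex blow-up along $\{(0,z,0,z):z\in\mathbb{C}\}$ and put $$\mathcal{G}:=\widetilde{\mathbb{C}^4}\setminus\overline{\beta^{-1}\big[(\{0\}\times\mathbb{C}\times\mathbb{C}^*\times\mathbb{C})\cup(\mathbb{C}^*\times\mathbb{C}\times\{0\}\times\mathbb{C})\big]}.$$ Then: 1. $U:=\beta^{-1}[(\mathbb{C}^*\times\mathbb{C})^{\times2}]$ is contained in $\mathcal{G}$, and $\beta:U\to(\mathbb{C}^*\times\mathbb{C})^{\times 2}$ is a (biholomorphic) diffeomorphism. 2. $\mathcal{G}$ has global holomorphic coordinates $(z,a,b,c)\in\mathbb{C}^4$, $b\neq0$, in which $\beta(z,a,b,c)=(a,z,ab,ac+z)$. 3. The pair groupoid structure on $(\mathbb{C}^*\times\mathbb{C})^{\times2}$ (the arrow $(p,q)$ has target $p$ and source $q$), transported to $U$ along $\beta$, extends uniquely to a smooth Lie groupoid structure $\mathcal{G}\rightrightarrows\mathbb{C}^2$. Its source and target are $s(z,a,b,c)=(ab,ac+z)$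 and $t(z,a,b,c)=(a,z)$. 4. This Lie groupoid integrates $\mathcal{A}$: its Lie algebroid (the bundle $\ker ds$ along the units, with anchor $dt$ and the bracket of right-invariant vector fields) is isomorphic to $\mathcal{A}$ as a Lie algebroid over $\mathbb{C}^2$. -/

import Mathlib

open scoped Manifold ContDiff LinearAlgebra.Projectivization Topology

noncomputable section

namespace EllipticModel

/-! ### Lie groupoids and their Lie algebroids -/

section LieGroupoid

variable (E : Type*) [NormedAddCommGroup E] [NormedSpace ℝ E]
  (G : Type*) [TopologicalSpace G] [ChartedSpace E G]
  (F : Type*) [NormedAddCommGroup F] [NormedSpace ℝ F]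
  (M : Type*) [TopologicalSpace M] [ChartedSpace F M]

/-- A Lie groupoid `G ⇉ M` (real, smooth). The product `mul g h _` is the arrow `g · h`, defined
exactly when `src g = tgt h`. The value of the map in `contMDiffOn_mul` at a pair that is not
composable is irrelevant, because smoothness is only required on the fibre product. -/
@[ext]
structure LieGroupoid where
  src : G → M
  tgt : G → M
  one : M → G
  inv : G → G
  mul : ∀ g h : G, src g = tgt h → G
  src_mul : ∀ g h (hgh : src g = tgt h), src (mul g h hgh) = src h
  tgt_mul : ∀ g h (hgh : src g = tgt h), tgt (mul g h hgh) = tgt g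
  mul_assoc : ∀ g h k (hgh : src g = tgt h) (hhk : src h = tgt k),
    mul (mul g h hgh) k ((src_mul g h hgh).trans hhk) =
      mul g (mul h k hhk) (hgh.trans (tgt_mul h k hhk).symm)
  src_one : ∀ x, src (one x) = x
  tgt_one : ∀ x, tgt (one x) = x
  one_mul : ∀ g, mul (one (tgt g)) g (src_one (tgt g)) = g
  mul_one : ∀ g, mul g (one (src g)) (tgt_one (src g)).symm = g
  src_inv : ∀ g, src (inv g) = tgt g
  tgt_inv : ∀ g, tgt (inv g) = src g
  inv_mul : ∀ g, mul (inv g) g (src_inv g) = one (src g)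
  mul_inv : ∀ g, mul g (inv g) (tgt_inv g).symm = one (tgt g)
  contMDiff_src : ContMDiff 𝓘(ℝ, E) 𝓘(ℝ, F) ∞ src
  contMDiff_tgt : ContMDiff 𝓘(ℝ, E) 𝓘(ℝ, F) ∞ tgt
  src_submersion : ∀ g, Function.Surjective (mfderiv 𝓘(ℝ, E) 𝓘(ℝ, F) src g)
  tgt_submersion : ∀ g, Function.Surjective (mfderiv 𝓘(ℝ, E) 𝓘(ℝ, F) tgt g)
  contMDiff_one : ContMDiff 𝓘(ℝ, F) 𝓘(ℝ, E) ∞ one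
  contMDiff_inv : ContMDiff 𝓘(ℝ, E) 𝓘(ℝ, E) ∞ inv
  contMDiffOn_mul : ContMDiffOn (𝓘(ℝ, E).prod 𝓘(ℝ, E)) 𝓘(ℝ, E) ∞
    (fun p : G × G => open Classical in if h : src p.1 = tgt p.2 then mul p.1 p.2 h else p.1)
    {p | src p.1 = tgt p.2}

end LieGroupoid

namespace LieGroupoid

variable {E : Type*} [NormedAddCommGroup E] [NormedSpace ℝ E]
  {G : Type*} [TopologicalSpace G] [ChartedSpace E G]
  {F : Type*} [NormedAddCommGroup F] [NormedSpace ℝ F]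
  {M : Type*} [TopologicalSpace M] [ChartedSpace F M]

/-- Right translation `g ↦ g · h`, meaningful on the source fibre `src ⁻¹ {tgt h}`. -/
def rightMul (𝒢 : LieGroupoid E G F M) (h g : G) : G :=
  open Classical in if hgh : 𝒢.src g = 𝒢.tgt h then 𝒢.mul g h hgh else g

/-- `X` is a smooth right-invariant vector field on the arrows: it is tangent to the source fibres,
and the differential of each right translation `src ⁻¹ {tgt h} → src ⁻¹ {src h}`, `g ↦ g · h`,
maps `X g` to `X (g · h)`. -/
structure IsRightInvariant [IsManifold 𝓘(ℝ, E) ∞ G] (𝒢 : LieGroupoid E G F M)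
    (X : ∀ g : G, TangentSpace 𝓘(ℝ, E) g) : Prop where
  smooth : ContMDiff 𝓘(ℝ, E) 𝓘(ℝ, E).tangent ∞ (fun g => (⟨g, X g⟩ : TangentBundle 𝓘(ℝ, E) G))
  vertical : ∀ g, mfderiv 𝓘(ℝ, E) 𝓘(ℝ, F) 𝒢.src g (X g) = 0
  invariant : ∀ g h, 𝒢.src g = 𝒢.tgt h →
    ∃ L : TangentSpace 𝓘(ℝ, E) g →L[ℝ] TangentSpace 𝓘(ℝ, E) (𝒢.rightMul h g),
      HasMFDerivWithinAt 𝓘(ℝ, E) 𝓘(ℝ, E) (𝒢.rightMul h) (𝒢.src ⁻¹' {𝒢.tgt h}) g L ∧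
        L (X g) = X (𝒢.rightMul h g)

/-- The bracket of the Lie algebroid `ker (d src)` along the units: `ρ = [σ, τ]` when `σ`, `τ`
extend to right-invariant vector fields whose Lie bracket restricts to `ρ` along the units. -/
def IsAlgebroidBracket [IsManifold 𝓘(ℝ, E) ∞ G] (𝒢 : LieGroupoid E G F M)
    (σ τ ρ : ∀ x : M, TangentSpace 𝓘(ℝ, E) (𝒢.one x)) : Prop :=
  ∃ X Y : ∀ g : G, TangentSpace 𝓘(ℝ, E) g,
    𝒢.IsRightInvariant X ∧ 𝒢.IsRightInvariant Y ∧
    (∀ x, X (𝒢.one x) = σ x) ∧ (∀ x, Y (𝒢.one x) = τ x) ∧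
    ∀ x, VectorField.mlieBracket 𝓘(ℝ, E) X Y (𝒢.one x) = ρ x

end LieGroupoid

/-! ### Cotangent Lie algebroids -/

section Cotangent

variable {F : Type*} [NormedAddCommGroup F] [NormedSpace ℝ F]

/-- The Lie derivative `L_X β` of a one-form along a vector field on a vector space. -/
def lieDerivForm (X : F → F) (β : F → F →L[ℝ] ℝ) (x : F) : F →L[ℝ] ℝ :=
  fderiv ℝ β x (X x) + (β x).comp (fderiv ℝ X x)

/-- The bracket of one-forms
`[α, β]_π = L_{π♯ α} β - L_{π♯ β} α - d ⟨β, π♯ α⟩` of a Poisson structure given by `π♯`. -/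
def koszulBracket (sharp : F → (F →L[ℝ] ℝ) →L[ℝ] F) (α β : F → F →L[ℝ] ℝ) (x : F) : F →L[ℝ] ℝ :=
  lieDerivForm (fun y => sharp y (α y)) β x - lieDerivForm (fun y => sharp y (β y)) α x
    - fderiv ℝ (fun y => β y (sharp y (α y))) x

variable {E : Type*} [NormedAddCommGroup E] [NormedSpace ℝ E]
  {G : Type*} [TopologicalSpace G] [ChartedSpace E G] [IsManifold 𝓘(ℝ, E) ∞ G]

/-- The Lie groupoid `𝒢 ⇉ F` integrates the cotangent Lie algebroid `(T*F, π♯, [·,·]_π)`: there is a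
smooth isomorphism `φ` of vector bundles over the identity from `T*F` to the Lie algebroid
`ker (d src)` along the units (with anchor `d tgt` and the bracket of right-invariant vector
fields) that intertwines the anchors and the brackets. -/
def IntegratesCotangent (𝒢 : LieGroupoid E G F F) (sharp : F → (F →L[ℝ] ℝ) →L[ℝ] F) : Prop :=
  ∃ φ : ∀ x : F, (F →L[ℝ] ℝ) →ₗ[ℝ] TangentSpace 𝓘(ℝ, E) (𝒢.one x),
    (∀ x, Function.Injective (φ x)) ∧
    (∀ x, Set.range (φ x) = {v | mfderiv 𝓘(ℝ, E) 𝓘(ℝ, F) 𝒢.src (𝒢.one x) v = 0}) ∧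
    (∀ α : F → F →L[ℝ] ℝ, ContDiff ℝ ∞ α →
      ContMDiff 𝓘(ℝ, F) 𝓘(ℝ, E).tangent ∞
        (fun x => (⟨𝒢.one x, φ x (α x)⟩ : TangentBundle 𝓘(ℝ, E) G))) ∧
    (∀ x ξ, mfderiv 𝓘(ℝ, E) 𝓘(ℝ, F) 𝒢.tgt (𝒢.one x) (φ x ξ) = sharp x ξ) ∧
    ∀ α β : F → F →L[ℝ] ℝ, ContDiff ℝ ∞ α → ContDiff ℝ ∞ β →
      𝒢.IsAlgebroidBracket (fun x => φ x (α x)) (fun x => φ x (β x))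
        (fun x => φ x (koszulBracket sharp α β x))

end Cotangent

/-! ### The elliptic Poisson structure on `ℝ⁴` with zero residue -/

/-- `ℝ⁴` with its coordinates `x₁, …, x₄` (indexed by `0, …, 3`). -/
abbrev R4 := Fin 4 → ℝ

/-- The linear coordinate forms on `ℝ⁴`. -/
abbrev coordForm (i : Fin 4) : R4 →L[ℝ] ℝ := ContinuousLinearMap.proj i

/-- The anchor of the elliptic tangent bundle of `(ℝ⁴, {x₁ = x₂ = 0})` in its global frame
`r∂_r = x₁∂₁ + x₂∂₂`, `∂_θ = x₁∂₂ - x₂∂₁`, `∂₃`, `∂₄`. -/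
def ellipticAnchor (x : R4) : R4 →L[ℝ] R4 :=
  (coordForm 0).smulRight ![x 0, x 1, 0, 0] + (coordForm 1).smulRight ![-x 1, x 0, 0, 0]
    + (coordForm 2).smulRight ![0, 0, 1, 0] + (coordForm 3).smulRight ![0, 0, 0, 1]

/-- The map `v ↦ (α ∧ β)(v, ·)`. -/
def wedgeFlat (α β : R4 →L[ℝ] ℝ) : R4 →L[ℝ] (R4 →L[ℝ] ℝ) := α.smulRight β - β.smulRight α

/-- `ω♭` for the elliptic symplectic form `ω = d log r ∧ dx₃ + dθ ∧ dx₄`; the coordinate forms with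
respect to the frame of the elliptic tangent bundle are `d log r`, `dθ`, `dx₃`, `dx₄`. -/
def ellipticFlat : R4 →L[ℝ] (R4 →L[ℝ] ℝ) :=
  wedgeFlat (coordForm 0) (coordForm 2) + wedgeFlat (coordForm 1) (coordForm 3)

/-- `π♯ = ρ ∘ (ω♭)⁻¹ ∘ ρ*`, where `ρ` is the anchor of the elliptic tangent bundle. -/
def ellipticSharp (x : R4) : (R4 →L[ℝ] ℝ) →L[ℝ] R4 :=
  (ellipticAnchor x).comp
    (ellipticFlat.inverse.comp (ContinuousLinearMap.precomp ℝ (ellipticAnchor x)))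

/-- The identification `ℝ⁴ ≅ ℂ²`, `x ↦ (x₁ + i x₂, x₃ - i x₄)`. -/
def realCoords : R4 ≃L[ℝ] ℂ × ℂ :=
  LinearEquiv.toContinuousLinearEquiv
    { toFun := fun x => (⟨x 0, x 1⟩, ⟨x 2, -x 3⟩)
      invFun := fun p => ![p.1.re, p.1.im, p.2.re, -p.2.im]
      map_add' := by
        intro x y
        refine Prod.ext (Complex.ext ?_ ?_) (Complex.ext ?_ ?_) <;> (simp; try ring)
      map_smul' := by
        intro c x
        refine Prod.ext (Complex.ext ?_ ?_) (Complex.ext ?_ ?_) <;> simp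
      left_inv := by
        intro x
        ext i
        fin_cases i <;> simp
      right_inv := by
        intro p
        ext <;> simp }

/-- The elliptic Poisson structure on `ℂ²`, transported from `ℝ⁴`. -/
def poissonSharp (p : ℂ × ℂ) : ((ℂ × ℂ) →L[ℝ] ℝ) →L[ℝ] ℂ × ℂ :=
  (realCoords : R4 →L[ℝ] ℂ × ℂ).comp
    ((ellipticSharp (realCoords.symm p)).comp
      (ContinuousLinearMap.precomp ℝ (realCoords : R4 →L[ℝ] ℂ × ℂ)))

/-- The form `ω` is nondegenerate. -/
theorem ellipticFlat_isInvertible : ellipticFlat.IsInvertible := by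
  let inv : (R4 →L[ℝ] ℝ) →ₗ[ℝ] R4 :=
    { toFun := fun α => ![α (Pi.single 2 1), α (Pi.single 3 1), -α (Pi.single 0 1),
        -α (Pi.single 1 1)]
      map_add' := by
        intro α β
        ext i
        fin_cases i <;> simp <;> ring
      map_smul' := by
        intro c α
        ext i
        fin_cases i <;> simp }
  let e : R4 ≃ₗ[ℝ] (R4 →L[ℝ] ℝ) :=
    { (ellipticFlat : R4 →ₗ[ℝ] (R4 →L[ℝ] ℝ)) with
      invFun := inv
      left_inv := by
        intro v
        ext i
        fin_cases i <;> simp [inv, ellipticFlat, wedgeFlat]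
      right_inv := by
        intro α
        refine ContinuousLinearMap.coe_injective (LinearMap.pi_ext' fun i => ?_)
        ext
        fin_cases i <;> simp [inv, ellipticFlat, wedgeFlat] }
  exact ⟨e.toContinuousLinearEquiv, by ext; rfl⟩

/-- `π♯ α = α(∂₃) r∂_r + α(∂₄) ∂_θ - α(r∂_r) ∂₃ - α(∂_θ) ∂₄`, that is,
`π = r∂_r ∧ ∂₃ + ∂_θ ∧ ∂₄` with the convention `π♯ α = π(·, α)`. -/
theorem ellipticSharp_apply (x : R4) (α : R4 →L[ℝ] ℝ) :
    ellipticSharp x α =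
      α ![0, 0, 1, 0] • ![x 0, x 1, 0, 0] + α ![0, 0, 0, 1] • ![-x 1, x 0, 0, 0]
        - α ![x 0, x 1, 0, 0] • ![0, 0, 1, 0] - α ![-x 1, x 0, 0, 0] • ![0, 0, 0, 1] := by
  have key : ellipticFlat.inverse (α.comp (ellipticAnchor x)) =
      ![α ![0, 0, 1, 0], α ![0, 0, 0, 1], -α ![x 0, x 1, 0, 0], -α ![-x 1, x 0, 0, 0]] := by
    obtain ⟨e, he⟩ := ellipticFlat_isInvertible
    rw [← he, ContinuousLinearMap.inverse_equiv]
    change e.symm _ = _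
    rw [ContinuousLinearEquiv.symm_apply_eq]
    change _ = (e : R4 →L[ℝ] (R4 →L[ℝ] ℝ)) _
    rw [he]
    ext v
    have hv : ellipticAnchor x v = v 0 • ![x 0, x 1, 0, 0] + v 1 • ![-x 1, x 0, 0, 0]
        + v 2 • ![0, 0, 1, 0] + v 3 • ![0, 0, 0, 1] := rfl
    rw [ContinuousLinearMap.comp_apply, hv]
    simp only [map_add, map_smul]
    simp [ellipticFlat, wedgeFlat]
    ring
  change ellipticAnchor x (ellipticFlat.inverse (α.comp (ellipticAnchor x))) = _
  rw [key]
  simp [ellipticAnchor, sub_eq_add_neg]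

/-! ### The blow-up of `ℂ⁴` along `{(0, z, 0, z)}` -/

/-- The quotient topology on the complex projective plane. -/
instance : TopologicalSpace (ℙ ℂ (Fin 3 → ℂ)) :=
  inferInstanceAs (TopologicalSpace (Quotient (projectivizationSetoid ℂ (Fin 3 → ℂ))))

/-- The linear equations `(p₁, q₁, q₂ - p₂)` of the centre `{((0, z), (0, z))}` of the blow-up; a
point of `ℂ⁴` is written as `(p, q)` with `p, q ∈ ℂ²`. -/
def centreEq (x : (ℂ × ℂ) × (ℂ × ℂ)) : Fin 3 → ℂ := ![x.1.1, x.2.1, x.2.2 - x.1.2]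

theorem centreEq_eq_zero_iff (x : (ℂ × ℂ) × (ℂ × ℂ)) :
    centreEq x = 0 ↔ ∃ z : ℂ, x = ((0, z), (0, z)) := by
  constructor
  · intro h
    have h0 := congrFun h 0
    have h1 := congrFun h 1
    have h2 := congrFun h 2
    simp [centreEq, sub_eq_zero] at h0 h1 h2
    exact ⟨x.1.2, by ext <;> simp [h0, h1, h2]⟩
  · rintro ⟨z, rfl⟩
    ext i
    fin_cases i <;> simp [centreEq]

/-- The blow-up of `ℂ⁴` along `{((0, z), (0, z))}`: pairs of a point `x` and a line in the normal
space `ℂ³` that contains `(p₁, q₁, q₂ - p₂)`. -/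
@[ext]
structure BlowUp where
  pt : (ℂ × ℂ) × (ℂ × ℂ)
  line : ℙ ℂ (Fin 3 → ℂ)
  mem : centreEq pt ∈ line.submodule

/-- The subspace topology from `ℂ⁴ × ℙ²`. -/
instance : TopologicalSpace BlowUp := TopologicalSpace.induced (fun y => (y.pt, y.line)) inferInstance

/-- The blow-down map `β`. -/
def blowDown (y : BlowUp) : (ℂ × ℂ) × (ℂ × ℂ) := y.pt

theorem continuous_pt_line : Continuous fun y : BlowUp => (y.pt, y.line) := continuous_induced_dom

theorem continuous_blowDown : Continuous blowDown := continuous_fst.comp continuous_pt_line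

/-- The model space of the blow-up, a copy of `ℂ⁴`. -/
abbrev ChartModel := ℂ × ℂ × (Fin 2 → ℂ)

/-- The vector with `i`-th entry `1` and the remaining entries given by `y`. -/
def affineVec (i : Fin 3) (y : Fin 2 → ℂ) : Fin 3 → ℂ := i.insertNth (1 : ℂ) y

/-- The ratio `l_j / l_i` of homogeneous coordinates. -/
def ratio (i j : Fin 3) (l : ℙ ℂ (Fin 3 → ℂ)) : ℂ := l.rep j / l.rep i

theorem ratio_mk (i j : Fin 3) (u : Fin 3 → ℂ) (hu : u ≠ 0) :
    ratio i j (Projectivization.mk ℂ u hu) = u j / u i := by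
  obtain ⟨a, ha⟩ := Projectivization.exists_smul_eq_mk_rep ℂ u hu
  rw [ratio, ← ha]
  simp only [Pi.smul_apply, Units.smul_def, smul_eq_mul]
  exact mul_div_mul_left _ _ a.ne_zero

theorem rep_mk_ne_zero_iff (i : Fin 3) (u : Fin 3 → ℂ) (hu : u ≠ 0) :
    (Projectivization.mk ℂ u hu).rep i ≠ 0 ↔ u i ≠ 0 := by
  obtain ⟨a, ha⟩ := Projectivization.exists_smul_eq_mk_rep ℂ u hu
  rw [← ha]
  simp [Units.smul_def]

theorem affineVec_ne_zero (i : Fin 3) (y : Fin 2 → ℂ) : affineVec i y ≠ 0 := by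
  intro h
  simpa [affineVec] using congrFun h i

/-- The parametrization of the `i`-th affine chart: the line is spanned by `u = affineVec i y` and
`(p₁, q₁, q₂ - p₂) = c • u`, `p₂ = z`. -/
def chartInv (i : Fin 3) (m : ChartModel) : BlowUp :=
  ⟨((m.2.1 * affineVec i m.2.2 0, m.1),
      (m.2.1 * affineVec i m.2.2 1, m.1 + m.2.1 * affineVec i m.2.2 2)),
    Projectivization.mk ℂ (affineVec i m.2.2) (affineVec_ne_zero i m.2.2), by
    rw [Projectivization.submodule_mk]
    refine Submodule.mem_span_singleton.2 ⟨m.2.1, ?_⟩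
    ext k
    fin_cases k <;> simp [centreEq]⟩

/-- The coordinates of the `i`-th affine chart: `p₂`, the `i`-th entry of `(p₁, q₁, q₂ - p₂)`, and
the two ratios of homogeneous coordinates of the line with denominator `l_i`. -/
def chartFun (i : Fin 3) (y : BlowUp) : ChartModel :=
  (y.pt.1.2, centreEq y.pt i, fun k => ratio i (i.succAbove k) y.line)

theorem isQuotientMap_mk : Topology.IsQuotientMap
    (fun v : {v : Fin 3 → ℂ // v ≠ 0} => Projectivization.mk ℂ v.1 v.2) :=
  isQuotientMap_quotient_mk'

theorem isOpen_rep_ne_zero (i : Fin 3) : IsOpen {l : ℙ ℂ (Fin 3 → ℂ) | l.rep i ≠ 0} := by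
  rw [← isQuotientMap_mk.isOpen_preimage]
  have : ((fun v : {v : Fin 3 → ℂ // v ≠ 0} => Projectivization.mk ℂ v.1 v.2) ⁻¹'
      {l : ℙ ℂ (Fin 3 → ℂ) | l.rep i ≠ 0}) = {v | v.1 i ≠ 0} := by
    ext v
    exact rep_mk_ne_zero_iff i v.1 v.2
  rw [this]
  exact isOpen_ne_fun ((continuous_apply i).comp continuous_subtype_val) continuous_const

theorem continuousOn_ratio (i j : Fin 3) :
    ContinuousOn (ratio i j) {l : ℙ ℂ (Fin 3 → ℂ) | l.rep i ≠ 0} := by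
  rw [isQuotientMap_mk.continuousOn_isOpen_iff (isOpen_rep_ne_zero i)]
  have : (ratio i j ∘ fun v : {v : Fin 3 → ℂ // v ≠ 0} => Projectivization.mk ℂ v.1 v.2) =
      fun v => v.1 j / v.1 i := by
    ext v
    exact ratio_mk i j v.1 v.2
  rw [this]
  refine ContinuousOn.div ?_ ?_ ?_
  · exact ((continuous_apply j).comp continuous_subtype_val).continuousOn
  · exact ((continuous_apply i).comp continuous_subtype_val).continuousOn
  · intro v hv
    exact (rep_mk_ne_zero_iff i v.1 v.2).1 hv

theorem continuous_affineVec (i : Fin 3) : Continuous (affineVec i) := by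
  unfold affineVec
  fun_prop

theorem affineVec_ratio (i : Fin 3) (l : ℙ ℂ (Fin 3 → ℂ)) (hl : l.rep i ≠ 0) :
    l.rep i • affineVec i (fun k => ratio i (i.succAbove k) l) = l.rep := by
  ext k
  refine Fin.succAboveCases i ?_ (fun k => ?_) k
  · simp [affineVec]
  · simp [affineVec, ratio]
    field_simp

/-- The `i`-th affine chart of the blow-up, defined where the `i`-th homogeneous coordinate of the
line does not vanish. -/
def blowUpChart (i : Fin 3) : OpenPartialHomeomorph BlowUp ChartModel where
  toFun := chartFun i
  invFun := chartInv i
  source := {y | y.line.rep i ≠ 0}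
  target := Set.univ
  map_source' := fun _ _ => Set.mem_univ _
  map_target' := by
    intro m _
    refine (rep_mk_ne_zero_iff i _ (affineVec_ne_zero i m.2.2)).2 ?_
    simp [affineVec]
  left_inv' := by
    rintro ⟨x, l, hx⟩ hl
    change l.rep i ≠ 0 at hl
    have hu := affineVec_ratio i l hl
    set u := affineVec i (fun k => ratio i (i.succAbove k) l) with hu_def
    have hui : u i = 1 := by simp [hu_def, affineVec]
    obtain ⟨t, ht⟩ : ∃ t : ℂ, t • u = centreEq x := by
      rw [Projectivization.submodule_eq] at hx
      obtain ⟨t, ht⟩ := Submodule.mem_span_singleton.1 hx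
      exact ⟨t * l.rep i, by rw [mul_smul, hu, ht]⟩
    have hti : centreEq x i = t := by rw [← ht]; simp [hui]
    have h0 := congrFun ht 0
    have h1 := congrFun ht 1
    have h2 := congrFun ht 2
    simp [centreEq] at h0 h1 h2
    refine BlowUp.ext ?_ ?_
    · change ((centreEq x i * u 0, x.1.2), (centreEq x i * u 1, x.1.2 + centreEq x i * u 2)) = x
      rw [hti, h0, h1, h2]
      ext <;> simp
    · change Projectivization.mk ℂ u _ = l
      conv_rhs => rw [← l.mk_rep]
      refine (Projectivization.mk_eq_mk_iff' ℂ _ _ _ _).2 ?_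
      exact ⟨(l.rep i)⁻¹, (inv_smul_eq_iff₀ hl).2 hu.symm⟩
  right_inv' := by
    rintro ⟨z, c, y⟩ -
    refine Prod.ext rfl (Prod.ext ?_ ?_)
    · have : centreEq (chartInv i (z, c, y)).pt = c • affineVec i y := by
        ext k
        fin_cases k <;> simp [centreEq, chartInv]
      change centreEq (chartInv i (z, c, y)).pt i = c
      rw [this]
      simp [affineVec]
    · ext k
      change ratio i (i.succAbove k) (Projectivization.mk ℂ (affineVec i y) _) = y k
      rw [ratio_mk]
      simp [affineVec]
  open_source := (isOpen_rep_ne_zero i).preimage (continuous_snd.comp continuous_pt_line)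
  open_target := isOpen_univ
  continuousOn_toFun := by
    have hx : Continuous fun y : BlowUp => y.pt := continuous_blowDown
    have hl : Continuous fun y : BlowUp => y.line := continuous_snd.comp continuous_pt_line
    have hc : Continuous fun y : BlowUp => centreEq y.pt := by
      refine continuous_pi fun k => ?_
      fin_cases k <;> simp only [centreEq] <;> simp <;> fun_prop
    refine ContinuousOn.prodMk (by fun_prop) (ContinuousOn.prodMk
      ((continuous_apply i).comp hc).continuousOn (continuousOn_pi.2 fun k => ?_))
    exact (continuousOn_ratio i (i.succAbove k)).comp hl.continuousOn fun y hy => hy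
  continuousOn_invFun := by
    have hu : Continuous fun m : ChartModel => affineVec i m.2.2 :=
      (continuous_affineVec i).comp (by fun_prop)
    have hk : ∀ k, Continuous fun m : ChartModel => affineVec i m.2.2 k :=
      fun k => (continuous_apply k).comp hu
    refine Continuous.continuousOn (continuous_induced_rng.2 (Continuous.prodMk ?_ ?_))
    · have h0 := hk 0
      have h1 := hk 1
      have h2 := hk 2
      fun_prop
    · exact isQuotientMap_mk.continuous.comp
        (hu.subtype_mk fun m => affineVec_ne_zero i m.2.2)

theorem exists_rep_ne_zero (y : BlowUp) : ∃ i : Fin 3, y.line.rep i ≠ 0 := by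
  by_contra! h
  exact y.line.rep_nonzero (funext h)

/-- The complex manifold structure of the blow-up, given by the three affine charts. -/
instance : ChartedSpace ChartModel BlowUp where
  atlas := Set.range blowUpChart
  chartAt y := blowUpChart (exists_rep_ne_zero y).choose
  mem_chart_source y := (exists_rep_ne_zero y).choose_spec
  chart_mem_atlas _ := Set.mem_range_self _

theorem contDiff_affineVec (i k : Fin 3) {n : ℕ∞ω} :
    ContDiff ℂ n fun m : ChartModel => affineVec i m.2.2 k := by
  refine Fin.succAboveCases i ?_ (fun k => ?_) k
  · simp only [affineVec, Fin.insertNth_apply_same]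
    exact contDiff_const
  · simp only [affineVec, Fin.insertNth_apply_succAbove]
    fun_prop

theorem contDiffOn_transition (i j : Fin 3) {n : ℕ∞ω} :
    ContDiffOn ℂ n (chartFun j ∘ chartInv i) {m | affineVec i m.2.2 j ≠ 0} := by
  have hfun : chartFun j ∘ chartInv i = fun m : ChartModel =>
      ((m.1, m.2.1 * affineVec i m.2.2 j,
        fun k => affineVec i m.2.2 (j.succAbove k) / affineVec i m.2.2 j) : ChartModel) := by
    funext m
    refine Prod.ext rfl (Prod.ext ?_ ?_)
    · change centreEq (chartInv i m).pt j = _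
      fin_cases j <;> simp [centreEq, chartInv]
    · funext k
      exact ratio_mk j (j.succAbove k) _ _
  rw [hfun]
  refine ContDiffOn.prodMk contDiff_fst.contDiffOn (ContDiffOn.prodMk ?_ ?_)
  · exact (ContDiff.mul (by fun_prop) (contDiff_affineVec i j)).contDiffOn
  · refine contDiffOn_pi.2 fun k => ?_
    exact (contDiff_affineVec i _).contDiffOn.div (contDiff_affineVec i j).contDiffOn fun m hm => hm

theorem transition_source (i j : Fin 3) :
    ((blowUpChart i).symm.trans (blowUpChart j)).source = {m | affineVec i m.2.2 j ≠ 0} := by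
  ext m
  have : m ∈ ((blowUpChart i).symm.trans (blowUpChart j)).source ↔
      (chartInv i m).line.rep j ≠ 0 := by
    change (True ∧ _) ↔ _
    exact iff_of_eq (true_and _)
  rw [this]
  exact rep_mk_ne_zero_iff j _ (affineVec_ne_zero i m.2.2)

@[simp]
theorem coe_blowUpChart (i : Fin 3) : (blowUpChart i : BlowUp → ChartModel) = chartFun i := rfl

@[simp]
theorem coe_blowUpChart_symm (i : Fin 3) :
    ((blowUpChart i).symm : ChartModel → BlowUp) = chartInv i := rfl

/-- The blow-up is a complex analytic manifold. -/
instance : IsManifold 𝓘(ℂ, ChartModel) ω BlowUp := by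
  refine isManifold_of_contDiffOn _ _ _ ?_
  rintro _ _ ⟨i, rfl⟩ ⟨j, rfl⟩
  have h := contDiffOn_transition i j (n := ω)
  rw [← transition_source] at h
  simpa using h

/-- The underlying smooth real manifold of the blow-up. -/
instance : IsManifold 𝓘(ℝ, ChartModel) ∞ BlowUp := by
  refine isManifold_of_contDiffOn _ _ _ ?_
  rintro _ _ ⟨i, rfl⟩ ⟨j, rfl⟩
  have h := (contDiffOn_transition i j (n := ∞)).restrict_scalars ℝ
  rw [← transition_source] at h
  simpa using h

/-! ### The arrow space and the pair groupoid -/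

/-- `(ℂ^* × ℂ) × (ℂ^* × ℂ)` as an open subset of `ℂ⁴`. -/
def pairArrows : TopologicalSpace.Opens ((ℂ × ℂ) × (ℂ × ℂ)) :=
  ⟨{x | x.1.1 ≠ 0 ∧ x.2.1 ≠ 0},
    (isOpen_ne_fun (by fun_prop) (by fun_prop)).inter (isOpen_ne_fun (by fun_prop) (by fun_prop))⟩

/-- The arrow space `𝒢`: the complement in the blow-up of the closure of the inverse image of
`({0} × ℂ × ℂ^* × ℂ) ∪ (ℂ^* × ℂ × {0} × ℂ)`. -/
def Arrows : TopologicalSpace.Opens BlowUp :=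
  ⟨(closure (blowDown ⁻¹' ({x | x.1.1 = 0 ∧ x.2.1 ≠ 0} ∪ {x | x.1.1 ≠ 0 ∧ x.2.1 = 0})))ᶜ,
    isClosed_closure.isOpen_compl⟩

/-- `β⁻¹((ℂ^* × ℂ)²)` inside the arrow space. -/
def regularArrows : TopologicalSpace.Opens Arrows :=
  ⟨{g | blowDown g.1 ∈ pairArrows},
    pairArrows.isOpen.preimage (continuous_blowDown.comp continuous_subtype_val)⟩

/-- The coordinate domain `{(z, a, b, c) | b ≠ 0}`. -/
def coordDomain : TopologicalSpace.Opens (ℂ × ℂ × ℂ × ℂ) :=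
  ⟨{m | m.2.2.1 ≠ 0}, isOpen_ne_fun (by fun_prop) (by fun_prop)⟩

/-- The structure maps of `𝒢` restrict, over `ℂ^* × ℂ`, to those of the pair groupoid, transported
along `β`: the arrow `(p, q)` has target `p` and source `q`, and `(p, q) · (q, r) = (p, r)`. -/
structure ExtendsPairGroupoid (𝒢 : LieGroupoid ChartModel Arrows (ℂ × ℂ) (ℂ × ℂ)) : Prop where
  tgt_eq : ∀ g ∈ regularArrows, 𝒢.tgt g = (blowDown g.1).1
  src_eq : ∀ g ∈ regularArrows, 𝒢.src g = (blowDown g.1).2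
  one_eq : ∀ p : ℂ × ℂ, p.1 ≠ 0 → blowDown (𝒢.one p).1 = (p, p)
  inv_eq : ∀ g ∈ regularArrows, blowDown (𝒢.inv g).1 = ((blowDown g.1).2, (blowDown g.1).1)
  mul_eq : ∀ g ∈ regularArrows, ∀ h ∈ regularArrows, ∀ hgh : 𝒢.src g = 𝒢.tgt h,
    blowDown (𝒢.mul g h hgh).1 = ((blowDown g.1).1, (blowDown h.1).2)

end EllipticModel

end

namespace EllipticModel

/-! ### The arrow space in the first affine chart -/

/-! The two hypersurfaces whose closure is removed are the proper transforms of the hyperplanes p₁ =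
0 and q₁ = 0. In homogeneous coordinates of the normal line they are l₀ = 0 and l₁ = 0
(`mem_arrows_iff`). Hence 𝒢 lies inside the affine chart l₀ ≠ 0, where b = l₁ / l₀ is nonzero and c
= l₂ / l₀ is free. In these coordinates β is (a, z; ab, ac + z), and division by a inverts it over a
≠ 0.

The formula for the source is a right action of the affine group {(b, c) : w ↦ bw + c} on ℂ², namely
(a, z)·(b, c) = (ab, ac + z). So 𝒢 is the action groupoid of this group: product and inverse are
regular for b ≠ 0, with no condition on a, and the groupoid axioms reduce to the group law and the
action law (`ellipticGroupoid`). As β = (t, s), the structure agrees with the pair groupoid where a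
≠ 0. Uniqueness is a density argument. Arrows with a ≠ 0 are dense, and composable pairs of such
arrows are dense among composable pairs (`dense_composable_regular`), so continuity and the
Hausdorff property determine every structure map (`eq_ellipticGroupoid`).

For the algebroid, a real form is written as v ↦ Re (C v₁ - B v₂) with complex B and C. Then π♯
becomes (B, C) ↦ (-p₁ B, -p₁ C) (`poissonSharp_apply`), which is the infinitesimal affine action
with a sign from right invariance. The pair (B, C) is therefore an element of the affine Lie
algebra, and a one-form is a function with values in that algebra. It generates the right-invariant
field `invariantField`, and the bracket of two such fields at the units is the Koszul bracket
(`lieBracket_invariantField`). The coordinates are a global diffeomorphism onto an open set, so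
`arrowField` carries these computations to 𝒢. -/

theorem eventually_add_ne_zero (c : ℂ) : ∀ᶠ t in 𝓝[≠] (0 : ℂ), c + t ≠ 0 := by
  by_cases hc : c = 0
  · filter_upwards [self_mem_nhdsWithin] with t ht
    simpa [hc] using ht
  · have h : ContinuousAt (fun t : ℂ => c + t) 0 := by fun_prop
    exact (h.eventually_ne (by simpa using hc)).filter_mono nhdsWithin_le_nhds

theorem centreEq_chartInv (i : Fin 3) (m : ChartModel) :
    centreEq (chartInv i m).pt = m.2.1 • affineVec i m.2.2 := by
  ext k
  fin_cases k <;> simp [centreEq, chartInv]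

theorem continuous_chartInv (i : Fin 3) : Continuous (chartInv i) :=
  continuousOn_univ.1 (blowUpChart i).continuousOn_invFun

theorem chartInv_chartFun {i : Fin 3} {y : BlowUp} (h : y.line.rep i ≠ 0) :
    chartInv i (chartFun i y) = y :=
  (blowUpChart i).left_inv h

theorem chartFun_chartInv (i : Fin 3) (m : ChartModel) : chartFun i (chartInv i m) = m :=
  (blowUpChart i).right_inv (Set.mem_univ m)

/-- The proper transform of a coordinate hyperplane that contains the centre lies in the closure
of its part off another coordinate hyperplane. -/
theorem mem_closure_of_rep_eq_zero {j k : Fin 3} (hjk : k ≠ j) {y : BlowUp}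
    (hj : y.line.rep j = 0) :
    y ∈ closure {x : BlowUp | centreEq x.pt j = 0 ∧ centreEq x.pt k ≠ 0} := by
  obtain ⟨i, hi⟩ := exists_rep_ne_zero y
  have hij : j ≠ i := fun h => hi (h ▸ hj)
  set m := chartFun i y with hm
  -- Curve through y in a chart l_i ≠ 0: the ratio l_j / l_i stays 0, while the other ratio and the
  -- scale of the normal vector move by t. For small t ≠ 0 the normal vector has j-th entry 0 and
  -- k-th entry nonzero.
  let w : Fin 2 → ℂ := fun l => if i.succAbove l = j then 0 else 1
  let γ : ℂ → BlowUp := fun t => chartInv i (m.1, m.2.1 + t, m.2.2 + t • w)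
  have hγ : Continuous γ := (continuous_chartInv i).comp (by fun_prop)
  have hγ0 : γ 0 = y := by simp [γ, hm, chartInv_chartFun hi]
  have hlim : Filter.Tendsto γ (𝓝[≠] 0) (𝓝 y) := by
    rw [← hγ0]
    exact hγ.continuousAt.tendsto.mono_left nhdsWithin_le_nhds
  have hmj : affineVec i m.2.2 j = 0 := by
    have := congrFun (affineVec_ratio i y.line hi) j
    rw [hj] at this
    simpa [hi, hm, chartFun] using this
  have hj0 : ∀ t : ℂ, affineVec i (m.2.2 + t • w) j = 0 := by
    intro t
    obtain ⟨l, rfl⟩ := Fin.exists_succAbove_eq hij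
    simpa [affineVec, w] using hmj
  have hk0 : ∀ᶠ t in 𝓝[≠] (0 : ℂ), affineVec i (m.2.2 + t • w) k ≠ 0 := by
    rcases eq_or_ne k i with rfl | hki
    · simp [affineVec]
    · obtain ⟨l, rfl⟩ := Fin.exists_succAbove_eq hki
      filter_upwards [eventually_add_ne_zero (m.2.2 l)] with t ht
      simpa [affineVec, w, hjk] using ht
  refine mem_closure_of_tendsto hlim ?_
  filter_upwards [hk0, eventually_add_ne_zero m.2.1] with t h1 h2
  change centreEq (chartInv i _).pt j = 0 ∧ centreEq (chartInv i _).pt k ≠ 0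
  simp [centreEq_chartInv, hj0, h1, h2]

/-- The normal vector is a multiple t of a spanning vector of the line, and its nonzero k-th entry
forces t ≠ 0. -/
theorem rep_eq_zero_of_centreEq {j k : Fin 3} {y : BlowUp} (hj : centreEq y.pt j = 0)
    (hk : centreEq y.pt k ≠ 0) : y.line.rep j = 0 := by
  have h := y.mem
  rw [Projectivization.submodule_eq] at h
  obtain ⟨t, ht⟩ := Submodule.mem_span_singleton.1 h
  rw [← ht] at hj hk
  simp only [Pi.smul_apply, smul_eq_mul, mul_eq_zero, ne_eq, not_or] at hj hk
  exact hj.resolve_left hk.1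

theorem mem_arrows_iff (y : BlowUp) : y ∈ Arrows ↔ y.line.rep 0 ≠ 0 ∧ y.line.rep 1 ≠ 0 := by
  change y ∉ closure _ ↔ _
  constructor
  · refine fun h => ⟨fun h0 => h ?_, fun h1 => h ?_⟩
    · refine closure_mono ?_ (mem_closure_of_rep_eq_zero (k := 1) (by decide) h0)
      rintro x ⟨hx, hx'⟩
      exact Or.inl ⟨hx, hx'⟩
    · refine closure_mono ?_ (mem_closure_of_rep_eq_zero (k := 0) (by decide) h1)
      rintro x ⟨hx, hx'⟩
      exact Or.inr ⟨hx', hx⟩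
  -- The condition l₀, l₁ ≠ 0 is open and fails on both removed pieces, so it excludes their
  -- closure.
  · rintro ⟨h0, h1⟩ h
    have hl : Continuous fun y : BlowUp => y.line := continuous_snd.comp continuous_pt_line
    have ho : IsOpen {x : BlowUp | x.line.rep 0 ≠ 0 ∧ x.line.rep 1 ≠ 0} :=
      ((isOpen_rep_ne_zero 0).preimage hl).inter ((isOpen_rep_ne_zero 1).preimage hl)
    obtain ⟨x, ⟨hx0, hx1⟩, hx | hx⟩ := mem_closure_iff.1 h _ ho ⟨h0, h1⟩
    · exact hx0 (rep_eq_zero_of_centreEq (k := 1) hx.1 hx.2)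
    · exact hx1 (rep_eq_zero_of_centreEq (k := 0) hx.2 hx.1)

/-! ### Coordinates on the arrow space and the blow-down map -/

/-- The coordinates `(z, a, ![b, c])` of an arrow. -/
noncomputable def coords (g : Arrows) : ChartModel := chartFun 0 g.1

theorem coords_ne_zero (g : Arrows) : (coords g).2.2 0 ≠ 0 := by
  obtain ⟨h0, h1⟩ := (mem_arrows_iff g.1).1 g.2
  exact div_ne_zero h1 h0

theorem chartInv_mem_arrows {m : ChartModel} (hm : m.2.2 0 ≠ 0) : chartInv 0 m ∈ Arrows := by
  rw [mem_arrows_iff]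
  constructor
  · exact (rep_mk_ne_zero_iff 0 _ (affineVec_ne_zero 0 m.2.2)).2 (by simp [affineVec])
  · refine (rep_mk_ne_zero_iff 1 _ (affineVec_ne_zero 0 m.2.2)).2 ?_
    have : (1 : Fin 3) = Fin.succAbove 0 (0 : Fin 2) := rfl
    rw [this]
    simpa [affineVec] using hm

/-- The arrow with coordinates `(z, a, ![b, c])`, where `b ≠ 0`. -/
noncomputable def ofCoords (m : ChartModel) (hm : m.2.2 0 ≠ 0) : Arrows :=
  ⟨chartInv 0 m, chartInv_mem_arrows hm⟩

@[simp]
theorem coords_ofCoords (m : ChartModel) (hm : m.2.2 0 ≠ 0) : coords (ofCoords m hm) = m :=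
  chartFun_chartInv 0 m

theorem chartInv_coords (g : Arrows) : chartInv 0 (coords g) = g.1 :=
  chartInv_chartFun ((mem_arrows_iff g.1).1 g.2).1

theorem coords_injective : Function.Injective coords := fun g h hgh => by
  rw [Subtype.ext_iff, ← chartInv_coords, hgh, chartInv_coords]

/-- The target map in coordinates. -/
def tgtCoords (m : ChartModel) : ℂ × ℂ := (m.2.1, m.1)

/-- The source map in coordinates. -/
def srcCoords (m : ChartModel) : ℂ × ℂ := (m.2.1 * m.2.2 0, m.2.1 * m.2.2 1 + m.1)

theorem blowDown_chartInv (m : ChartModel) :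
    blowDown (chartInv 0 m) = (tgtCoords m, srcCoords m) := by
  have h1 : affineVec 0 m.2.2 1 = m.2.2 0 := rfl
  have h2 : affineVec 0 m.2.2 2 = m.2.2 1 := rfl
  have h0 : affineVec 0 m.2.2 0 = 1 := rfl
  simp only [blowDown, chartInv, tgtCoords, srcCoords, h0, h1, h2, mul_one, add_comm]

theorem blowDown_coords (g : Arrows) :
    blowDown g.1 = (tgtCoords (coords g), srcCoords (coords g)) := by
  rw [← blowDown_chartInv, chartInv_coords]

/-- The first source coordinate is ab with b ≠ 0, so the two conditions of the pair groupoid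
collapse to a ≠ 0. -/
theorem mem_regularArrows_iff (g : Arrows) : g ∈ regularArrows ↔ (coords g).2.1 ≠ 0 := by
  change ((blowDown g.1).1.1 ≠ 0 ∧ (blowDown g.1).2.1 ≠ 0) ↔ _
  rw [blowDown_coords]
  simp [tgtCoords, srcCoords, coords_ne_zero g]

/-- The coordinates of the arrow over a point of the pair groupoid. -/
noncomputable def pairCoords (x : (ℂ × ℂ) × (ℂ × ℂ)) : ChartModel :=
  (x.1.2, x.1.1, ![x.2.1 / x.1.1, (x.2.2 - x.1.2) / x.1.1])

theorem pairCoords_blowDown {g : Arrows} (hg : g ∈ regularArrows) :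
    pairCoords (blowDown g.1) = coords g := by
  rw [mem_regularArrows_iff] at hg
  rw [blowDown_coords]
  refine Prod.ext rfl (Prod.ext rfl (funext fun k => ?_))
  fin_cases k <;> simp [pairCoords, tgtCoords, srcCoords] <;> field_simp

/-- Regularity of one of the two arrows suffices, since it is read off from the image under β. This
is how equality of arrows is checked in the uniqueness proof. -/
theorem blowDown_injOn {g h : Arrows} (hg : g ∈ regularArrows)
    (hgh : blowDown g.1 = blowDown h.1) : g = h := by
  have hh : h ∈ regularArrows := by
    change blowDown h.1 ∈ pairArrows
    rw [← hgh]
    exact hg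
  apply coords_injective
  rw [← pairCoords_blowDown hg, ← pairCoords_blowDown hh, hgh]

theorem preimage_pairArrows_subset : blowDown ⁻¹' pairArrows ⊆ Arrows := by
  rintro y ⟨h0, h1⟩
  refine (mem_arrows_iff y).2 ⟨fun h => ?_, fun h => ?_⟩
  all_goals
    have hm := y.mem
    rw [Projectivization.submodule_eq] at hm
    obtain ⟨t, ht⟩ := Submodule.mem_span_singleton.1 hm
  · have h' : centreEq y.pt 0 = 0 := by simpa [h] using (congrFun ht 0).symm
    exact h0 h'
  · have h' : centreEq y.pt 1 = 0 := by simpa [h] using (congrFun ht 1).symm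
    exact h1 h'

theorem continuous_coords : Continuous coords :=
  (blowUpChart 0).continuousOn_toFun.comp_continuous continuous_subtype_val
    fun g => ((mem_arrows_iff g.1).1 g.2).1

instance : T2Space Arrows := T2Space.of_injective_continuous coords_injective continuous_coords

/-! ### Density of the regular arrows -/

/-- The arrow obtained from `g` by a translation of the coordinate `a`. -/
noncomputable def shift (g : Arrows) (t : ℂ) : Arrows :=
  ofCoords ((coords g).1, (coords g).2.1 + t, (coords g).2.2) (coords_ne_zero g)

theorem continuous_shift (g : Arrows) : Continuous (shift g) :=
  ((continuous_chartInv 0).comp (by fun_prop)).subtype_mk _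

@[simp]
theorem shift_zero (g : Arrows) : shift g 0 = g := by
  apply coords_injective
  simp [shift]

theorem eventually_shift_mem (g : Arrows) : ∀ᶠ t in 𝓝[≠] (0 : ℂ), shift g t ∈ regularArrows := by
  filter_upwards [eventually_add_ne_zero (coords g).2.1] with t ht
  rw [mem_regularArrows_iff]
  simpa [shift] using ht

theorem dense_regularArrows : Dense (regularArrows : Set Arrows) := fun g => by
  have h : Filter.Tendsto (shift g) (𝓝[≠] 0) (𝓝 g) := by
    have := (continuous_shift g).tendsto 0
    rw [shift_zero] at this
    exact this.mono_left nhdsWithin_le_nhds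
  exact mem_closure_of_tendsto h (eventually_shift_mem g)

/-! ### Smooth maps in coordinates -/

section Smooth

instance : IsManifold 𝓘(ℂ, ChartModel) ∞ BlowUp := IsManifold.of_le (n := ω) le_top

variable {𝕜 : Type*} [NontriviallyNormedField 𝕜] [NormedSpace 𝕜 ChartModel]
  [IsManifold 𝓘(𝕜, ChartModel) ∞ BlowUp]
  {V : Type*} [NormedAddCommGroup V] [NormedSpace 𝕜 V] {H : Type*} [TopologicalSpace H]
  {I : ModelWithCorners 𝕜 V H} {N : Type*} [TopologicalSpace N] [ChartedSpace H N]

theorem blowUpChart_mem_maximalAtlas (i : Fin 3) :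
    blowUpChart i ∈ IsManifold.maximalAtlas 𝓘(𝕜, ChartModel) ∞ BlowUp :=
  IsManifold.subset_maximalAtlas (Set.mem_range_self i)

theorem contMDiff_coords : ContMDiff 𝓘(𝕜, ChartModel) 𝓘(𝕜, ChartModel) ∞ coords := by
  have h := contMDiffOn_of_mem_maximalAtlas (blowUpChart_mem_maximalAtlas (𝕜 := 𝕜) 0)
  exact h.comp_contMDiff contMDiff_subtype_val fun g => ((mem_arrows_iff g.1).1 g.2).1

theorem contMDiff_chartInv : ContMDiff 𝓘(𝕜, ChartModel) 𝓘(𝕜, ChartModel) ∞ (chartInv 0) := by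
  have h := contMDiffOn_symm_of_mem_maximalAtlas (blowUpChart_mem_maximalAtlas (𝕜 := 𝕜) 0)
  exact contMDiffOn_univ.1 h

/-- The inclusion of 𝒢 into the blow-up is `chartInv 0 ∘ coords`, so smoothness into 𝒢 can be tested
in coordinates. The field is kept general: ℂ serves the biholomorphisms, ℝ the Lie groupoid. -/
theorem contMDiffOn_of_coords {f : N → Arrows} {s : Set N}
    (h : ContMDiffOn I 𝓘(𝕜, ChartModel) ∞ (fun x => coords (f x)) s) :
    ContMDiffOn I 𝓘(𝕜, ChartModel) ∞ f s := fun x hx => by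
  rw [← ContMDiffWithinAt.subtypeVal_comp_iff]
  have := (contMDiff_chartInv (𝕜 := 𝕜)).contMDiffAt.comp_contMDiffWithinAt x (h x hx)
  refine this.congr (fun y _ => ?_) ?_ <;> exact (chartInv_coords _).symm

theorem contMDiff_of_coords {f : N → Arrows}
    (h : ContMDiff I 𝓘(𝕜, ChartModel) ∞ fun x => coords (f x)) :
    ContMDiff I 𝓘(𝕜, ChartModel) ∞ f :=
  contMDiffOn_univ.1 (contMDiffOn_of_coords h.contMDiffOn)

end Smooth

/-! ### The structure maps in coordinates -/

/-- The product of arrows in coordinates. -/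
noncomputable def mulCoords (m n : ChartModel) : ChartModel :=
  (m.1, m.2.1, ![m.2.2 0 * n.2.2 0, m.2.2 0 * n.2.2 1 + m.2.2 1])

/-- The inverse of an arrow in coordinates. -/
noncomputable def invCoords (m : ChartModel) : ChartModel :=
  ((srcCoords m).2, (srcCoords m).1, ![(m.2.2 0)⁻¹, -(m.2.2 0)⁻¹ * m.2.2 1])

/-- The unit arrows in coordinates. -/
noncomputable def oneCoords (p : ℂ × ℂ) : ChartModel := (p.2, p.1, ![1, 0])

theorem mulCoords_ne_zero {m n : ChartModel} (hm : m.2.2 0 ≠ 0) (hn : n.2.2 0 ≠ 0) :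
    (mulCoords m n).2.2 0 ≠ 0 :=
  mul_ne_zero hm hn

theorem invCoords_ne_zero {m : ChartModel} (hm : m.2.2 0 ≠ 0) : (invCoords m).2.2 0 ≠ 0 :=
  inv_ne_zero hm

theorem oneCoords_ne_zero (p : ℂ × ℂ) : (oneCoords p).2.2 0 ≠ 0 :=
  one_ne_zero

theorem pairCoords_ne_zero {x : (ℂ × ℂ) × (ℂ × ℂ)} (hx : x ∈ pairArrows) :
    (pairCoords x).2.2 0 ≠ 0 :=
  div_ne_zero hx.2 hx.1

/-- The identification of `ℂ⁴` with the model space of the blow-up. -/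
noncomputable def toModel (m : ℂ × ℂ × ℂ × ℂ) : ChartModel := (m.1, m.2.1, ![m.2.2.1, m.2.2.2])

theorem toModel_ne_zero {m : ℂ × ℂ × ℂ × ℂ} (hm : m ∈ coordDomain) : (toModel m).2.2 0 ≠ 0 :=
  hm

section ContDiff

variable (𝕜 : Type*) [NontriviallyNormedField 𝕜] [NormedAlgebra 𝕜 ℂ]

theorem contDiffOn_vec {V : Type*} [NormedAddCommGroup V] [NormedSpace 𝕜 V] {f g : V → ℂ}
    {s : Set V} {n : ℕ∞ω} (hf : ContDiffOn 𝕜 n f s) (hg : ContDiffOn 𝕜 n g s) :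
    ContDiffOn 𝕜 n (fun x => ![f x, g x]) s := by
  refine contDiffOn_pi.2 fun k => ?_
  fin_cases k
  · exact hf
  · exact hg

theorem contDiff_tgtCoords {n : ℕ∞ω} : ContDiff 𝕜 n tgtCoords := by
  unfold tgtCoords
  fun_prop

theorem contDiff_srcCoords {n : ℕ∞ω} : ContDiff 𝕜 n srcCoords := by
  unfold srcCoords
  fun_prop

theorem contDiff_mulCoords {n : ℕ∞ω} :
    ContDiff 𝕜 n fun p : ChartModel × ChartModel => mulCoords p.1 p.2 := by
  rw [← contDiffOn_univ]
  refine ContDiffOn.prodMk (by fun_prop) (ContDiffOn.prodMk (by fun_prop) (contDiffOn_vec 𝕜 ?_ ?_))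
    <;> fun_prop

theorem contDiff_oneCoords {n : ℕ∞ω} : ContDiff 𝕜 n oneCoords := by
  unfold oneCoords
  fun_prop

theorem contDiffOn_invCoords {n : ℕ∞ω} :
    ContDiffOn 𝕜 n invCoords {m : ChartModel | m.2.2 0 ≠ 0} := by
  have hb : ContDiffOn 𝕜 n (fun m : ChartModel => (m.2.2 0)⁻¹) {m | m.2.2 0 ≠ 0} :=
    ContDiffOn.inv (by fun_prop) fun _ hm => hm
  have hs := contDiff_srcCoords 𝕜 (n := n)
  refine ContDiffOn.prodMk (by fun_prop) (ContDiffOn.prodMk (by fun_prop) (contDiffOn_vec 𝕜 hb ?_))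
  exact hb.neg.mul (by fun_prop)

theorem contDiff_toModel {n : ℕ∞ω} : ContDiff 𝕜 n toModel := by
  rw [← contDiffOn_univ]
  refine ContDiffOn.prodMk (by fun_prop) (ContDiffOn.prodMk (by fun_prop) (contDiffOn_vec 𝕜 ?_ ?_))
    <;> fun_prop

theorem contDiffOn_pairCoords {n : ℕ∞ω} : ContDiffOn 𝕜 n pairCoords pairArrows := by
  have ha : ContDiffOn 𝕜 n (fun x : (ℂ × ℂ) × (ℂ × ℂ) => (x.1.1)⁻¹) pairArrows :=
    ContDiffOn.inv (by fun_prop) fun _ hx => hx.1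
  refine ContDiffOn.prodMk (by fun_prop) (ContDiffOn.prodMk (by fun_prop) (contDiffOn_vec 𝕜 ?_ ?_))
  all_goals
    simp only [div_eq_mul_inv]
    exact ContDiffOn.mul (by fun_prop) ha

end ContDiff

/-! ### Biholomorphisms -/

/-- The blow-down map restricts to a biholomorphism over `(ℂ^* × ℂ)²`. -/
noncomputable def regularDiffeomorph :
    regularArrows ≃ₘ^∞⟮𝓘(ℂ, ChartModel), 𝓘(ℂ, (ℂ × ℂ) × (ℂ × ℂ))⟯ pairArrows where
  toFun g := ⟨blowDown g.1.1, g.2⟩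
  invFun x := ⟨ofCoords (pairCoords x.1) (pairCoords_ne_zero x.2),
    (mem_regularArrows_iff _).2 (by simpa [pairCoords] using x.2.1)⟩
  left_inv g := by
    refine Subtype.ext (coords_injective ?_)
    simpa using pairCoords_blowDown g.2
  right_inv x := by
    have ha : x.1.1.1 ≠ 0 := x.2.1
    refine Subtype.ext ?_
    change blowDown (ofCoords _ (pairCoords_ne_zero x.2)).1 = _
    rw [blowDown_coords, coords_ofCoords]
    simp [pairCoords, tgtCoords, srcCoords, mul_div_cancel₀, ha]
  contMDiff_toFun := by
    rw [← ContMDiff.subtypeVal_comp_iff]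
    have h : ContMDiff 𝓘(ℂ, ChartModel) 𝓘(ℂ, (ℂ × ℂ) × (ℂ × ℂ)) ∞
        fun m => (tgtCoords m, srcCoords m) :=
      ((contDiff_tgtCoords ℂ).prodMk (contDiff_srcCoords ℂ)).contMDiff
    refine (h.comp (contMDiff_coords.comp contMDiff_subtype_val)).congr fun g => ?_
    exact blowDown_coords g.1
  contMDiff_invFun := by
    rw [← ContMDiff.subtypeVal_comp_iff]
    refine contMDiff_of_coords ?_
    have h := (contDiffOn_pairCoords ℂ (n := ∞)).contMDiffOn
    refine (h.comp_contMDiff contMDiff_subtype_val fun x => x.2).congr fun x => ?_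
    exact coords_ofCoords _ (pairCoords_ne_zero x.2)

/-- The global holomorphic coordinates `(z, a, b, c)` on the arrow space. -/
noncomputable def coordDiffeomorph :
    coordDomain ≃ₘ^∞⟮𝓘(ℂ, ℂ × ℂ × ℂ × ℂ), 𝓘(ℂ, ChartModel)⟯ Arrows where
  toFun m := ofCoords (toModel m.1) (toModel_ne_zero m.2)
  invFun g := ⟨((coords g).1, (coords g).2.1, (coords g).2.2 0, (coords g).2.2 1), coords_ne_zero g⟩
  left_inv m := by
    refine Subtype.ext ?_
    simp [toModel]
  right_inv g := by
    apply coords_injective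
    rw [coords_ofCoords]
    refine Prod.ext rfl (Prod.ext rfl (funext fun k => ?_))
    fin_cases k <;> rfl
  contMDiff_toFun := by
    refine contMDiff_of_coords ?_
    refine ((contDiff_toModel ℂ).contMDiff.comp contMDiff_subtype_val).congr fun m => ?_
    exact coords_ofCoords _ (toModel_ne_zero m.2)
  contMDiff_invFun := by
    rw [← ContMDiff.subtypeVal_comp_iff]
    have h : ContDiff ℂ ∞ fun m : ChartModel => (m.1, m.2.1, m.2.2 0, m.2.2 1) := by fun_prop
    exact h.contMDiff.comp contMDiff_coords

/-! ### The groupoid -/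

/-- Differentiating f ∘ σ = id at f g gives a right inverse of the differential, provided that the
section passes through g. -/
theorem surjective_mfderiv_of_section {f : Arrows → ℂ × ℂ} {g : Arrows} {σ : ℂ × ℂ → Arrows}
    (hf : ContMDiff 𝓘(ℝ, ChartModel) 𝓘(ℝ, ℂ × ℂ) ∞ f)
    (hσ : ContMDiff 𝓘(ℝ, ℂ × ℂ) 𝓘(ℝ, ChartModel) ∞ σ) (hg : σ (f g) = g)
    (hfσ : ∀ x, f (σ x) = x) :
    Function.Surjective (mfderiv 𝓘(ℝ, ChartModel) 𝓘(ℝ, ℂ × ℂ) f g) := by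
  have h1 : HasMFDerivAt 𝓘(ℝ, ChartModel) 𝓘(ℝ, ℂ × ℂ) f (σ (f g))
      (mfderiv 𝓘(ℝ, ChartModel) 𝓘(ℝ, ℂ × ℂ) f (σ (f g))) :=
    (hf.mdifferentiableAt (by simp)).hasMFDerivAt
  have h2 := (hσ.mdifferentiableAt (x := f g) (by simp)).hasMFDerivAt
  have h3 := h1.comp (f g) h2
  have h4 : f ∘ σ = id := funext hfσ
  rw [h4] at h3
  have h5 := hasMFDerivAt_unique h3 (hasMFDerivAt_id (f g))
  rw [hg] at h5
  intro v
  exact ⟨_, DFunLike.congr_fun h5 v⟩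

/-- The extension of the pair groupoid of `ℂ^* × ℂ` to the arrow space. -/
noncomputable def ellipticGroupoid : LieGroupoid ChartModel Arrows (ℂ × ℂ) (ℂ × ℂ) where
  src g := srcCoords (coords g)
  tgt g := tgtCoords (coords g)
  one p := ofCoords (oneCoords p) (oneCoords_ne_zero p)
  inv g := ofCoords (invCoords (coords g)) (invCoords_ne_zero (coords_ne_zero g))
  -- The group components multiply in the affine group and the base point is that of g.
  -- Composability enters only in the source of the product.
  mul g h _ := ofCoords (mulCoords (coords g) (coords h))
    (mulCoords_ne_zero (coords_ne_zero g) (coords_ne_zero h))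
  src_mul g h hgh := by
    simp only [srcCoords, tgtCoords, Prod.mk.injEq] at hgh
    simp [srcCoords, mulCoords, ← hgh.1, ← hgh.2]
    constructor <;> ring
  tgt_mul g h hgh := by simp [tgtCoords, mulCoords]
  mul_assoc g h k _ _ := by
    apply coords_injective
    simp [mulCoords]
    constructor <;> ring
  src_one x := by simp [srcCoords, oneCoords]
  tgt_one x := by simp [tgtCoords, oneCoords]
  one_mul g := by
    apply coords_injective
    simp only [coords_ofCoords]
    refine Prod.ext rfl (Prod.ext rfl (funext fun k => ?_))
    fin_cases k <;> simp [mulCoords, oneCoords]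
  mul_one g := by
    apply coords_injective
    simp only [coords_ofCoords]
    refine Prod.ext rfl (Prod.ext rfl (funext fun k => ?_))
    fin_cases k <;> simp [mulCoords, oneCoords]
  src_inv g := by
    have := coords_ne_zero g
    simp [srcCoords, tgtCoords, invCoords]
    field_simp
    simp
  tgt_inv g := by simp [tgtCoords, invCoords]
  inv_mul g := by
    apply coords_injective
    simp [mulCoords, invCoords, oneCoords, coords_ne_zero g]
  mul_inv g := by
    apply coords_injective
    simp [mulCoords, invCoords, oneCoords, coords_ne_zero g, tgtCoords]
  contMDiff_src := (contDiff_srcCoords ℝ).contMDiff.comp contMDiff_coords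
  contMDiff_tgt := (contDiff_tgtCoords ℝ).contMDiff.comp contMDiff_coords
  src_submersion g := by
    have hb := coords_ne_zero g
    set b := (coords g).2.2 0 with hb_def
    -- The section keeps the group element (b, c) of g fixed and solves ab = u₁, ac + z = u₂ for a
    -- and z.
    refine surjective_mfderiv_of_section
      (σ := fun u => ofCoords (u.2 - u.1 * b⁻¹ * (coords g).2.2 1, u.1 * b⁻¹, (coords g).2.2) hb)
      ((contDiff_srcCoords ℝ).contMDiff.comp contMDiff_coords) ?_ ?_ ?_
    · refine contMDiff_of_coords ?_
      simp only [coords_ofCoords]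
      exact ContDiff.contMDiff (by fun_prop)
    · apply coords_injective
      simp only [coords_ofCoords, srcCoords, ← hb_def]
      refine Prod.ext ?_ (Prod.ext ?_ rfl) <;> simp [hb]
    · intro x
      simp [srcCoords, ← hb_def, hb]
  tgt_submersion g := by
    refine surjective_mfderiv_of_section
      (σ := fun u => ofCoords (u.2, u.1, (coords g).2.2) (coords_ne_zero g))
      ((contDiff_tgtCoords ℝ).contMDiff.comp contMDiff_coords) ?_ ?_ ?_
    · refine contMDiff_of_coords ?_
      simp only [coords_ofCoords]
      exact ContDiff.contMDiff (by fun_prop)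
    · apply coords_injective
      simp [tgtCoords]
    · intro x
      simp [tgtCoords]
  contMDiff_one := by
    refine contMDiff_of_coords ?_
    simp only [coords_ofCoords]
    exact (contDiff_oneCoords ℝ).contMDiff
  contMDiff_inv := by
    refine contMDiff_of_coords ?_
    simp only [coords_ofCoords]
    exact (contDiffOn_invCoords ℝ).contMDiffOn.comp_contMDiff contMDiff_coords coords_ne_zero
  contMDiffOn_mul := by
    refine contMDiffOn_of_coords ?_
    have h : ContMDiff (𝓘(ℝ, ChartModel).prod 𝓘(ℝ, ChartModel)) 𝓘(ℝ, ChartModel) ∞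
        fun p : Arrows × Arrows => mulCoords (coords p.1) (coords p.2) :=
      (contDiff_mulCoords ℝ).contMDiff.comp
        ((contMDiff_coords.comp contMDiff_fst).prodMk_space (contMDiff_coords.comp contMDiff_snd))
    refine h.contMDiffOn.congr fun p hp => ?_
    rw [Set.mem_ofPred_eq] at hp
    simp [hp]

/-- In coordinates β is (t, s) on all of 𝒢, so the conditions on inverses and products are just the
source and target axioms. -/
theorem extendsPairGroupoid_ellipticGroupoid : ExtendsPairGroupoid ellipticGroupoid where
  tgt_eq g _ := by rw [blowDown_coords]; rfl
  src_eq g _ := by rw [blowDown_coords]; rfl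
  one_eq p _ := by
    rw [blowDown_coords]
    simp [ellipticGroupoid, tgtCoords, srcCoords, oneCoords]
  inv_eq g _ := by
    rw [blowDown_coords, blowDown_coords]
    exact Prod.ext (ellipticGroupoid.tgt_inv g) (ellipticGroupoid.src_inv g)
  mul_eq g _ h _ hgh := by
    rw [blowDown_coords, blowDown_coords, blowDown_coords]
    exact Prod.ext (ellipticGroupoid.tgt_mul g h hgh) (ellipticGroupoid.src_mul g h hgh)

/-! ### Uniqueness of the extension -/

theorem dense_composable_regular :
    {p : Arrows × Arrows | ellipticGroupoid.src p.1 = ellipticGroupoid.tgt p.2} ⊆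
      closure {p | (p.1 ∈ regularArrows ∧ p.2 ∈ regularArrows) ∧
        ellipticGroupoid.src p.1 = ellipticGroupoid.tgt p.2} := by
  rintro ⟨g, h⟩ hgh
  have hgh' : srcCoords (coords g) = tgtCoords (coords h) := hgh
  simp only [srcCoords, tgtCoords, Prod.mk.injEq] at hgh'
  let b := (coords g).2.2 0
  let c := (coords g).2.2 1
  -- When a is replaced by a + t in g, its source moves by (tb, tc). The second arrow is moved so
  -- that its target follows.
  let k : ℂ → Arrows := fun t =>
    ofCoords ((coords h).1 + t * c, (coords h).2.1 + t * b, (coords h).2.2) (coords_ne_zero h)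
  have hk : Continuous k := ((continuous_chartInv 0).comp (by fun_prop)).subtype_mk _
  have hk0 : k 0 = h := by
    apply coords_injective
    simp [k]
  have hlim : Filter.Tendsto (fun t => (shift g t, k t)) (𝓝[≠] 0) (𝓝 (g, h)) := by
    have := ((continuous_shift g).prodMk hk).tendsto 0
    rw [shift_zero, hk0] at this
    exact this.mono_left nhdsWithin_le_nhds
  refine mem_closure_of_tendsto hlim ?_
  filter_upwards [eventually_shift_mem g] with t ht
  have ht' := (mem_regularArrows_iff _).1 ht
  simp only [shift, coords_ofCoords] at ht'
  refine ⟨⟨ht, ?_⟩, ?_⟩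
  · rw [mem_regularArrows_iff]
    have : (coords h).2.1 + t * b = ((coords g).2.1 + t) * b := by rw [← hgh'.1]; ring
    simp only [k, coords_ofCoords, this]
    exact mul_ne_zero ht' (coords_ne_zero g)
  · simp only [ellipticGroupoid, shift, k, coords_ofCoords, srcCoords, tgtCoords, Prod.mk.injEq,
      ← hgh'.1, ← hgh'.2, b, c]
    constructor <;> ring

theorem eq_ellipticGroupoid (𝒢 : LieGroupoid ChartModel Arrows (ℂ × ℂ) (ℂ × ℂ))
    (h𝒢 : ExtendsPairGroupoid 𝒢) : 𝒢 = ellipticGroupoid := by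
  have hE := extendsPairGroupoid_ellipticGroupoid
  have hsrc : 𝒢.src = ellipticGroupoid.src :=
    𝒢.contMDiff_src.continuous.ext_on dense_regularArrows
      ellipticGroupoid.contMDiff_src.continuous fun g hg => by rw [h𝒢.src_eq g hg, hE.src_eq g hg]
  have htgt : 𝒢.tgt = ellipticGroupoid.tgt :=
    𝒢.contMDiff_tgt.continuous.ext_on dense_regularArrows
      ellipticGroupoid.contMDiff_tgt.continuous fun g hg => by rw [h𝒢.tgt_eq g hg, hE.tgt_eq g hg]
  have hinv : 𝒢.inv = ellipticGroupoid.inv := by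
    refine 𝒢.contMDiff_inv.continuous.ext_on dense_regularArrows
      ellipticGroupoid.contMDiff_inv.continuous fun g hg => (blowDown_injOn ?_ ?_).symm
    · change blowDown (ellipticGroupoid.inv g).1 ∈ pairArrows
      rw [hE.inv_eq g hg]
      exact ⟨hg.2, hg.1⟩
    · rw [h𝒢.inv_eq g hg, hE.inv_eq g hg]
  have hone : 𝒢.one = ellipticGroupoid.one := by
    have hd : Dense {p : ℂ × ℂ | p.1 ≠ 0} := by
      have := (dense_compl_singleton (0 : ℂ)).preimage (isOpenMap_fst (X := ℂ) (Y := ℂ))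
      exact this
    refine 𝒢.contMDiff_one.continuous.ext_on hd
      ellipticGroupoid.contMDiff_one.continuous fun p hp => (blowDown_injOn ?_ ?_).symm
    · change blowDown (ellipticGroupoid.one p).1 ∈ pairArrows
      rw [hE.one_eq p hp]
      exact ⟨hp, hp⟩
    · rw [h𝒢.one_eq p hp, hE.one_eq p hp]
  have hmul : ∀ g h (h₁ : 𝒢.src g = 𝒢.tgt h)
      (h₂ : ellipticGroupoid.src g = ellipticGroupoid.tgt h),
      𝒢.mul g h h₁ = ellipticGroupoid.mul g h h₂ := by
    -- Only the restriction to the fibre product is continuous, so density must be used inside the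
    -- fibre product; density in the product space would not suffice.
    have hc := 𝒢.contMDiffOn_mul.continuousOn
    replace hc := hc.mono
      (t := {p : Arrows × Arrows | ellipticGroupoid.src p.1 = ellipticGroupoid.tgt p.2})
      (by rw [hsrc, htgt])
    have key := Set.EqOn.of_subset_closure (fun p hp => ?_) hc
      ellipticGroupoid.contMDiffOn_mul.continuousOn (fun p hp => hp.2) dense_composable_regular
    · intro g h h₁ h₂
      simpa [h₁, h₂] using key (show (g, h) ∈ {p : Arrows × Arrows | _} from h₂)
    · obtain ⟨⟨hg, hh⟩, h₂⟩ := hp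
      have h₁ : 𝒢.src p.1 = 𝒢.tgt p.2 := by rw [hsrc, htgt, h₂]
      simp only [h₁, h₂, dite_true]
      refine (blowDown_injOn ?_ ?_).symm
      · change blowDown (ellipticGroupoid.mul _ _ h₂).1 ∈ pairArrows
        rw [hE.mul_eq _ hg _ hh]
        exact ⟨hg.1, hh.2⟩
      · rw [h𝒢.mul_eq _ hg _ hh, hE.mul_eq _ hg _ hh]
  refine LieGroupoid.ext hsrc htgt hone hinv ?_
  -- The composability proof taken by `mul` has a type that depends on source and target, hence a
  -- heterogeneous comparison, argument by argument.
  refine Function.hfunext rfl fun g g' hg => ?_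
  obtain rfl := eq_of_heq hg
  refine Function.hfunext rfl fun h h' hh => ?_
  obtain rfl := eq_of_heq hh
  refine Function.hfunext (by rw [hsrc, htgt]) fun h₁ h₂ _ => ?_
  exact heq_of_eq (hmul g h h₁ h₂)

/-! ### The Poisson structure in complex coordinates -/

/-- The complex coefficient `B` of a real form `v ↦ Re (C v₁ - B v₂)` on `ℂ²`. -/
noncomputable def formB : ((ℂ × ℂ) →L[ℝ] ℝ) →L[ℝ] ℂ :=
  (ContinuousLinearMap.apply ℝ ℝ ((0, Complex.I) : ℂ × ℂ)).smulRight Complex.I -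
    (ContinuousLinearMap.apply ℝ ℝ ((0, 1) : ℂ × ℂ)).smulRight (1 : ℂ)

/-- The complex coefficient `C` of a real form `v ↦ Re (C v₁ - B v₂)` on `ℂ²`. -/
noncomputable def formC : ((ℂ × ℂ) →L[ℝ] ℝ) →L[ℝ] ℂ :=
  (ContinuousLinearMap.apply ℝ ℝ ((1, 0) : ℂ × ℂ)).smulRight (1 : ℂ) -
    (ContinuousLinearMap.apply ℝ ℝ ((Complex.I, 0) : ℂ × ℂ)).smulRight Complex.I

theorem formB_apply (ξ : (ℂ × ℂ) →L[ℝ] ℝ) :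
    formB ξ = ξ (0, Complex.I) * Complex.I - ξ (0, 1) := by
  simp [formB]

theorem formC_apply (ξ : (ℂ × ℂ) →L[ℝ] ℝ) :
    formC ξ = ξ (1, 0) - ξ (Complex.I, 0) * Complex.I := by
  simp [formC]

theorem form_eq_re (ξ : (ℂ × ℂ) →L[ℝ] ℝ) (v : ℂ × ℂ) :
    ξ v = (formC ξ * v.1 - formB ξ * v.2).re := by
  have hv : v = v.1.re • ((1, 0) : ℂ × ℂ) + v.1.im • ((Complex.I, 0) : ℂ × ℂ)
      + v.2.re • ((0, 1) : ℂ × ℂ) + v.2.im • ((0, Complex.I) : ℂ × ℂ) := by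
    ext <;> simp
  conv_lhs => rw [hv]
  simp only [map_add, map_smul, formB_apply, formC_apply]
  simp
  ring

/-- With `formC_eq`: the complex coefficients are unique, which allows them to be read off from a
real-part formula such as that of the Koszul bracket. -/
theorem formB_eq {ξ : (ℂ × ℂ) →L[ℝ] ℝ} {B C : ℂ} (h : ∀ v, ξ v = (C * v.1 - B * v.2).re) :
    formB ξ = B := by
  apply Complex.ext <;> simp [formB_apply, h]

theorem formC_eq {ξ : (ℂ × ℂ) →L[ℝ] ℝ} {B C : ℂ} (h : ∀ v, ξ v = (C * v.1 - B * v.2).re) :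
    formC ξ = C := by
  apply Complex.ext <;> simp [formC_apply, h]

/-- With w = x₃ - i x₄, the bivector π is 4 Re (z₁ ∂_{z₁} ∧ ∂_w), so π♯ is complex linear in the
pair (B, C). -/
theorem poissonSharp_apply (p : ℂ × ℂ) (ξ : (ℂ × ℂ) →L[ℝ] ℝ) :
    poissonSharp p ξ = (-(p.1 * formB ξ), -(p.1 * formC ξ)) := by
  change realCoords (ellipticSharp (realCoords.symm p)
    (ξ.comp (realCoords : R4 →L[ℝ] ℂ × ℂ))) = _
  have hr : ∀ x : R4, realCoords x = (⟨x 0, x 1⟩, ⟨x 2, -x 3⟩) := fun _ => rfl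
  have hs : realCoords.symm p = ![p.1.re, p.1.im, p.2.re, -p.2.im] := rfl
  rw [ellipticSharp_apply, hs]
  simp only [ContinuousLinearMap.comp_apply, ContinuousLinearEquiv.coe_coe]
  simp only [hr, form_eq_re ξ]
  refine Prod.ext (Complex.ext ?_ ?_) (Complex.ext ?_ ?_) <;> simp <;> ring

/-! ### Derivatives along lines and the Koszul bracket -/

theorem hasDerivAt_add_smul {V : Type*} [NormedAddCommGroup V] [NormedSpace ℝ V] (x v : V) :
    HasDerivAt (fun t : ℝ => x + t • v) v 0 := by
  simpa using ((hasDerivAt_id (0 : ℝ)).smul_const v).const_add x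

theorem hasDerivAt_comp_line {V W : Type*} [NormedAddCommGroup V] [NormedSpace ℝ V]
    [NormedAddCommGroup W] [NormedSpace ℝ W] {f : V → W} {x : V} (hf : DifferentiableAt ℝ f x)
    (v : V) : HasDerivAt (fun t : ℝ => f (x + t • v)) (fderiv ℝ f x v) 0 :=
  hf.hasFDerivAt.hasLineDerivAt v

theorem hasDerivAt_formB {α : ℂ × ℂ → (ℂ × ℂ) →L[ℝ] ℝ} (hα : ContDiff ℝ ∞ α) (x v : ℂ × ℂ) :
    HasDerivAt (fun t : ℝ => formB (α (x + t • v))) (formB (fderiv ℝ α x v)) 0 :=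
  formB.hasFDerivAt.comp_hasDerivAt 0
    (hasDerivAt_comp_line (hα.differentiable (by simp)).differentiableAt v)

theorem hasDerivAt_formC {α : ℂ × ℂ → (ℂ × ℂ) →L[ℝ] ℝ} (hα : ContDiff ℝ ∞ α) (x v : ℂ × ℂ) :
    HasDerivAt (fun t : ℝ => formC (α (x + t • v))) (formC (fderiv ℝ α x v)) 0 :=
  formC.hasFDerivAt.comp_hasDerivAt 0
    (hasDerivAt_comp_line (hα.differentiable (by simp)).differentiableAt v)

theorem contDiff_poissonSharp {α : ℂ × ℂ → (ℂ × ℂ) →L[ℝ] ℝ} (hα : ContDiff ℝ ∞ α) :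
    ContDiff ℝ ∞ fun x => poissonSharp x (α x) := by
  have hB : ContDiff ℝ ∞ fun x => formB (α x) := formB.contDiff.comp hα
  have hC : ContDiff ℝ ∞ fun x => formC (α x) := formC.contDiff.comp hα
  simp only [poissonSharp_apply]
  fun_prop

theorem fderiv_poissonSharp {α : ℂ × ℂ → (ℂ × ℂ) →L[ℝ] ℝ} (hα : ContDiff ℝ ∞ α)
    (x v : ℂ × ℂ) :
    fderiv ℝ (fun y => poissonSharp y (α y)) x v =
      (-(v.1 * formB (α x) + x.1 * formB (fderiv ℝ α x v)),
        -(v.1 * formC (α x) + x.1 * formC (fderiv ℝ α x v))) := by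
  refine (hasDerivAt_comp_line
    ((contDiff_poissonSharp hα).differentiable (by simp)).differentiableAt v).unique ?_
  simp only [poissonSharp_apply]
  have h1 : HasDerivAt (fun t : ℝ => (x + t • v).1) v.1 0 := hasDerivAt_add_smul x.1 v.1
  simpa using (h1.mul (hasDerivAt_formB hα x v)).neg.prodMk (h1.mul (hasDerivAt_formC hα x v)).neg

/-- The terms β(D(π♯α) v) cancel between L_{π♯α} β and d⟨β, π♯α⟩. By antisymmetry of π, the term
Dβ(v)(π♯α) cancels the part of α(D(π♯β) v) that differentiates β. What is left is the derivative of
each form along the anchor of the other, plus the derivative of the factor p₁ in π♯, which gives the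
affine Lie bracket term. -/
theorem koszulBracket_apply {α β : ℂ × ℂ → (ℂ × ℂ) →L[ℝ] ℝ} (hα : ContDiff ℝ ∞ α)
    (hβ : ContDiff ℝ ∞ β) (x v : ℂ × ℂ) :
    koszulBracket poissonSharp α β x v =
      ((formC (fderiv ℝ β x (poissonSharp x (α x))) - formC (fderiv ℝ α x (poissonSharp x (β x)))
          + (formC (α x) * formB (β x) - formC (β x) * formB (α x))) * v.1
        - (formB (fderiv ℝ β x (poissonSharp x (α x)))
          - formB (fderiv ℝ α x (poissonSharp x (β x)))) * v.2).re := by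
  have h : fderiv ℝ (fun y => β y (poissonSharp y (α y))) x v =
      fderiv ℝ β x v (poissonSharp x (α x)) +
        β x (fderiv ℝ (fun y => poissonSharp y (α y)) x v) := by
    rw [fderiv_clm_apply (hβ.differentiable (by simp)).differentiableAt
      ((contDiff_poissonSharp hα).differentiable (by simp)).differentiableAt]
    simp [add_comm]
  have h' : koszulBracket poissonSharp α β x v =
      fderiv ℝ β x (poissonSharp x (α x)) v - fderiv ℝ α x (poissonSharp x (β x)) v
        - α x (fderiv ℝ (fun y => poissonSharp y (β y)) x v)
        - fderiv ℝ β x v (poissonSharp x (α x)) := by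
    change (fderiv ℝ β x (poissonSharp x (α x)) v
        + β x (fderiv ℝ (fun y => poissonSharp y (α y)) x v))
      - (fderiv ℝ α x (poissonSharp x (β x)) v
        + α x (fderiv ℝ (fun y => poissonSharp y (β y)) x v))
      - fderiv ℝ (fun y => β y (poissonSharp y (α y))) x v = _
    rw [h]
    ring
  rw [h', fderiv_poissonSharp hβ, form_eq_re (fderiv ℝ β x (poissonSharp x (α x))),
    form_eq_re (fderiv ℝ α x (poissonSharp x (β x))), form_eq_re (α x),
    form_eq_re (fderiv ℝ β x v), poissonSharp_apply x (α x)]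
  simp only [← Complex.sub_re]
  congr 1
  ring

/-! ### Right-invariant vector fields in coordinates -/

/-- The right-invariant vector field determined by a one-form. -/
noncomputable def invariantField (α : ℂ × ℂ → (ℂ × ℂ) →L[ℝ] ℝ) (m : ChartModel) : ChartModel :=
  (-(m.2.1 * formC (α (tgtCoords m))), -(m.2.1 * formB (α (tgtCoords m))),
    ![m.2.2 0 * formB (α (tgtCoords m)),
      m.2.2 1 * formB (α (tgtCoords m)) + formC (α (tgtCoords m))])

theorem contDiff_invariantField {α : ℂ × ℂ → (ℂ × ℂ) →L[ℝ] ℝ} (hα : ContDiff ℝ ∞ α) :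
    ContDiff ℝ ∞ (invariantField α) := by
  have hB : ContDiff ℝ ∞ fun m => formB (α (tgtCoords m)) :=
    formB.contDiff.comp (hα.comp (contDiff_tgtCoords ℝ))
  have hC : ContDiff ℝ ∞ fun m => formC (α (tgtCoords m)) :=
    formC.contDiff.comp (hα.comp (contDiff_tgtCoords ℝ))
  rw [← contDiffOn_univ]
  refine ContDiffOn.prodMk (by fun_prop) (ContDiffOn.prodMk (by fun_prop) (contDiffOn_vec ℝ ?_ ?_))
    <;> fun_prop

theorem tgtCoords_invariantField (α : ℂ × ℂ → (ℂ × ℂ) →L[ℝ] ℝ) (m : ChartModel) :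
    tgtCoords (invariantField α m) = poissonSharp (tgtCoords m) (α (tgtCoords m)) := by
  rw [poissonSharp_apply]
  rfl

theorem fderiv_invariantField {α : ℂ × ℂ → (ℂ × ℂ) →L[ℝ] ℝ} (hα : ContDiff ℝ ∞ α)
    (m v : ChartModel) :
    fderiv ℝ (invariantField α) m v =
      (-(v.2.1 * formC (α (tgtCoords m))
          + m.2.1 * formC (fderiv ℝ α (tgtCoords m) (tgtCoords v))),
        -(v.2.1 * formB (α (tgtCoords m))
          + m.2.1 * formB (fderiv ℝ α (tgtCoords m) (tgtCoords v))),
        ![v.2.2 0 * formB (α (tgtCoords m))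
            + m.2.2 0 * formB (fderiv ℝ α (tgtCoords m) (tgtCoords v)),
          v.2.2 1 * formB (α (tgtCoords m))
            + m.2.2 1 * formB (fderiv ℝ α (tgtCoords m) (tgtCoords v))
            + formC (fderiv ℝ α (tgtCoords m) (tgtCoords v))]) := by
  refine (hasDerivAt_comp_line
    ((contDiff_invariantField hα).differentiable (by simp)).differentiableAt v).unique ?_
  have ha : HasDerivAt (fun t : ℝ => (m + t • v).2.1) v.2.1 0 := hasDerivAt_add_smul m.2.1 v.2.1
  have hb : ∀ k, HasDerivAt (fun t : ℝ => (m + t • v).2.2 k) (v.2.2 k) 0 :=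
    fun k => hasDerivAt_add_smul (m.2.2 k) (v.2.2 k)
  have hB : HasDerivAt (fun t : ℝ => formB (α (tgtCoords (m + t • v)))) _ 0 :=
    hasDerivAt_formB hα (tgtCoords m) (tgtCoords v)
  have hC : HasDerivAt (fun t : ℝ => formC (α (tgtCoords (m + t • v)))) _ 0 :=
    hasDerivAt_formC hα (tgtCoords m) (tgtCoords v)
  refine HasDerivAt.prodMk ?_ (HasDerivAt.prodMk ?_ (hasDerivAt_pi.2 fun k => ?_))
  · refine (ha.mul hC).neg.congr_deriv ?_
    simp
  · refine (ha.mul hB).neg.congr_deriv ?_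
    simp
  · fin_cases k
    · refine ((hb 0).mul hB).congr_deriv ?_
      simp
    · refine (((hb 1).mul hB).add hC).congr_deriv ?_
      simp

/-- The fields project to π♯α and π♯β under the target, so the derivatives of the coefficients match
those in the Koszul bracket. At a unit the quadratic terms in B cancel by symmetry, and the mixed
terms give the affine bracket. -/
theorem lieBracket_invariantField {α β : ℂ × ℂ → (ℂ × ℂ) →L[ℝ] ℝ} (hα : ContDiff ℝ ∞ α)
    (hβ : ContDiff ℝ ∞ β) (x : ℂ × ℂ) :
    VectorField.lieBracket ℝ (invariantField α) (invariantField β) (oneCoords x) =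
      invariantField (koszulBracket poissonSharp α β) (oneCoords x) := by
  have hx : tgtCoords (oneCoords x) = x := rfl
  have hB := formB_eq (koszulBracket_apply hα hβ x)
  have hC := formC_eq (koszulBracket_apply hα hβ x)
  rw [VectorField.lieBracket, fderiv_invariantField hα, fderiv_invariantField hβ,
    tgtCoords_invariantField, tgtCoords_invariantField]
  simp only [invariantField, hx, hB, hC]
  refine Prod.ext ?_ (Prod.ext ?_ (funext fun k => ?_))
  · simp [oneCoords]
    ring
  · simp [oneCoords]
    ring
  · fin_cases k <;> simp [oneCoords] <;> ring

/-! ### Verticality and right invariance -/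

theorem fderiv_srcCoords (m v : ChartModel) :
    fderiv ℝ srcCoords m v =
      (v.2.1 * m.2.2 0 + m.2.1 * v.2.2 0, v.2.1 * m.2.2 1 + m.2.1 * v.2.2 1 + v.1) := by
  refine (hasDerivAt_comp_line ((contDiff_srcCoords ℝ (n := 1)).differentiable
    (by simp)).differentiableAt v).unique ?_
  have hz : HasDerivAt (fun t : ℝ => (m + t • v).1) v.1 0 := hasDerivAt_add_smul m.1 v.1
  have ha : HasDerivAt (fun t : ℝ => (m + t • v).2.1) v.2.1 0 := hasDerivAt_add_smul m.2.1 v.2.1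
  have hb : ∀ k, HasDerivAt (fun t : ℝ => (m + t • v).2.2 k) (v.2.2 k) 0 :=
    fun k => hasDerivAt_add_smul (m.2.2 k) (v.2.2 k)
  refine ((ha.mul (hb 0)).prodMk ((ha.mul (hb 1)).add hz)).congr_deriv ?_
  simp

theorem fderiv_tgtCoords (m v : ChartModel) : fderiv ℝ tgtCoords m v = tgtCoords v :=
  (hasDerivAt_comp_line ((contDiff_tgtCoords ℝ (n := 1)).differentiable
    (by simp)).differentiableAt v).unique (hasDerivAt_add_smul (tgtCoords m) (tgtCoords v))

theorem fderiv_mulCoords_left (m n v : ChartModel) :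
    fderiv ℝ (fun m => mulCoords m n) m v =
      (v.1, v.2.1, ![v.2.2 0 * n.2.2 0, v.2.2 0 * n.2.2 1 + v.2.2 1]) := by
  have hd : ContDiff ℝ 1 fun m => mulCoords m n :=
    (contDiff_mulCoords ℝ).comp (contDiff_id.prodMk contDiff_const)
  refine (hasDerivAt_comp_line (hd.differentiable (by simp)).differentiableAt v).unique ?_
  have hb : ∀ k, HasDerivAt (fun t : ℝ => (m + t • v).2.2 k) (v.2.2 k) 0 :=
    fun k => hasDerivAt_add_smul (m.2.2 k) (v.2.2 k)
  refine HasDerivAt.prodMk (hasDerivAt_add_smul m.1 v.1)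
    (HasDerivAt.prodMk (hasDerivAt_add_smul m.2.1 v.2.1) (hasDerivAt_pi.2 fun k => ?_))
  fin_cases k
  · exact (hb 0).mul_const _
  · exact ((hb 0).mul_const _).add (hb 1)

/-- The base components of the field are chosen to compensate the motion of (b, c), so that ab and
ac + z stay constant to first order. -/
theorem fderiv_srcCoords_invariantField (α : ℂ × ℂ → (ℂ × ℂ) →L[ℝ] ℝ) (m : ChartModel) :
    fderiv ℝ srcCoords m (invariantField α m) = 0 := by
  rw [fderiv_srcCoords]
  refine Prod.ext ?_ ?_ <;> simp [invariantField] <;> ring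

/-- The components (bB, cB + C) are the infinitesimal left multiplication by (B, C) in the affine
group, which commutes with right translations; the coefficients depend only on the target, which
these preserve. -/
theorem fderiv_mulCoords_invariantField (α : ℂ × ℂ → (ℂ × ℂ) →L[ℝ] ℝ) (m n : ChartModel) :
    fderiv ℝ (fun m => mulCoords m n) m (invariantField α m) =
      invariantField α (mulCoords m n) := by
  have ht : tgtCoords (mulCoords m n) = tgtCoords m := rfl
  rw [fderiv_mulCoords_left]
  simp only [invariantField, ht]
  refine Prod.ext ?_ (Prod.ext ?_ (funext fun k => ?_))
  · simp [mulCoords]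
  · simp [mulCoords]
  · fin_cases k <;> simp [mulCoords] <;> ring

/-! ### The Lie algebroid of the groupoid -/

/-- The differential of the coordinates. -/
noncomputable def dCoords (g : Arrows) : TangentSpace 𝓘(ℝ, ChartModel) g →L[ℝ] ChartModel :=
  mfderiv 𝓘(ℝ, ChartModel) 𝓘(ℝ, ChartModel) coords g

theorem hasMFDerivAt_coords (g : Arrows) :
    HasMFDerivAt 𝓘(ℝ, ChartModel) 𝓘(ℝ, ChartModel) coords g (dCoords g) :=
  (contMDiff_coords.mdifferentiableAt (by simp)).hasMFDerivAt

theorem isInvertible_dCoords (g : Arrows) : (dCoords g).IsInvertible := by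
  classical
  -- Inverse of the coordinates, with the junk value g where b = 0. Only the open set b ≠ 0 matters
  -- for the derivative at `coords g`.
  let σ : ChartModel → Arrows := fun m => if hm : m.2.2 0 ≠ 0 then ofCoords m hm else g
  have ho : IsOpen {m : ChartModel | m.2.2 0 ≠ 0} := isOpen_ne_fun (by fun_prop) (by fun_prop)
  have hσ : ∀ m : ChartModel, m.2.2 0 ≠ 0 → coords (σ m) = m := fun m hm => by simp [σ, hm]
  have hσ' : ∀ g, σ (coords g) = g := fun g => coords_injective (hσ _ (coords_ne_zero g))
  have hd : ContMDiffOn 𝓘(ℝ, ChartModel) 𝓘(ℝ, ChartModel) ∞ σ {m | m.2.2 0 ≠ 0} :=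
    contMDiffOn_of_coords (contMDiffOn_id.congr fun m hm => hσ m hm)
  have hd' := ((hd.contMDiffAt (ho.mem_nhds (coords_ne_zero g))).mdifferentiableAt
    (by simp)).hasMFDerivAt
  have h1 := hd'.comp g (hasMFDerivAt_coords g)
  rw [show σ ∘ coords = id from funext hσ'] at h1
  have h1' := hasMFDerivAt_unique h1 (hasMFDerivAt_id g)
  have hc := hasMFDerivAt_coords (σ (coords g))
  have h2 := hc.comp (coords g) hd'
  have h3 : id =ᶠ[𝓝 (coords g)] coords ∘ σ := by
    filter_upwards [ho.mem_nhds (coords_ne_zero g)] with m hm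
    exact (hσ m hm).symm
  have h2' := hasMFDerivAt_unique (h2.congr_of_eventuallyEq h3) (hasMFDerivAt_id _)
  rw [hσ'] at h2'
  exact ContinuousLinearMap.IsInvertible.of_inverse h2' h1'

theorem dCoords_inverse (g : Arrows) (v : ChartModel) : dCoords g ((dCoords g).inverse v) = v := by
  obtain ⟨e, he⟩ := isInvertible_dCoords g
  rw [← he, ContinuousLinearMap.inverse_equiv]
  exact e.apply_symm_apply v

theorem dCoords_injective (g : Arrows) : Function.Injective (dCoords g) := by
  obtain ⟨e, he⟩ := isInvertible_dCoords g
  rw [← he]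
  exact e.injective

theorem mfderiv_comp_coords {f : ChartModel → ℂ × ℂ} {g : Arrows}
    (hf : DifferentiableAt ℝ f (coords g)) (v : TangentSpace 𝓘(ℝ, ChartModel) g) :
    mfderiv 𝓘(ℝ, ChartModel) 𝓘(ℝ, ℂ × ℂ) (fun g => f (coords g)) g v =
      fderiv ℝ f (coords g) (dCoords g v) := by
  have h := hf.hasFDerivAt.hasMFDerivAt.comp g (hasMFDerivAt_coords g)
  exact DFunLike.congr_fun h.mfderiv v

theorem mfderiv_src (g : Arrows) (v : TangentSpace 𝓘(ℝ, ChartModel) g) :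
    mfderiv 𝓘(ℝ, ChartModel) 𝓘(ℝ, ℂ × ℂ) ellipticGroupoid.src g v =
      fderiv ℝ srcCoords (coords g) (dCoords g v) :=
  mfderiv_comp_coords ((contDiff_srcCoords ℝ (n := 1)).differentiable (by simp)).differentiableAt v

theorem mfderiv_tgt (g : Arrows) (v : TangentSpace 𝓘(ℝ, ChartModel) g) :
    mfderiv 𝓘(ℝ, ChartModel) 𝓘(ℝ, ℂ × ℂ) ellipticGroupoid.tgt g v =
      fderiv ℝ tgtCoords (coords g) (dCoords g v) :=
  mfderiv_comp_coords ((contDiff_tgtCoords ℝ (n := 1)).differentiable (by simp)).differentiableAt v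

/-- The right-invariant vector field on the arrow space determined by a one-form. -/
noncomputable def arrowField (α : ℂ × ℂ → (ℂ × ℂ) →L[ℝ] ℝ) (g : Arrows) :
    TangentSpace 𝓘(ℝ, ChartModel) g :=
  VectorField.mpullback 𝓘(ℝ, ChartModel) 𝓘(ℝ, ChartModel) coords (invariantField α) g

theorem dCoords_arrowField (α : ℂ × ℂ → (ℂ × ℂ) →L[ℝ] ℝ) (g : Arrows) :
    dCoords g (arrowField α g) = invariantField α (coords g) :=
  dCoords_inverse g _

theorem contMDiff_invariantField {α : ℂ × ℂ → (ℂ × ℂ) →L[ℝ] ℝ} (hα : ContDiff ℝ ∞ α) :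
    ContMDiff 𝓘(ℝ, ChartModel) 𝓘(ℝ, ChartModel).tangent ∞
      (fun m => (⟨m, invariantField α m⟩ : TangentBundle 𝓘(ℝ, ChartModel) ChartModel)) :=
  contMDiff_vectorSpace_iff_contDiff.2 (contDiff_invariantField hα)

theorem contMDiff_arrowField {α : ℂ × ℂ → (ℂ × ℂ) →L[ℝ] ℝ} (hα : ContDiff ℝ ∞ α) :
    ContMDiff 𝓘(ℝ, ChartModel) 𝓘(ℝ, ChartModel).tangent ∞
      (fun g => (⟨g, arrowField α g⟩ : TangentBundle 𝓘(ℝ, ChartModel) Arrows)) :=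
  ContMDiff.mpullback_vectorField (contMDiff_invariantField hα) (contMDiff_coords (𝕜 := ℝ))
    isInvertible_dCoords (by simp)

theorem isRightInvariant_arrowField {α : ℂ × ℂ → (ℂ × ℂ) →L[ℝ] ℝ} (hα : ContDiff ℝ ∞ α) :
    ellipticGroupoid.IsRightInvariant (arrowField α) where
  smooth := contMDiff_arrowField hα
  vertical g := by
    rw [mfderiv_src, dCoords_arrowField, fderiv_srcCoords_invariantField]
    rfl
  invariant g h hgh := by
    -- The coordinate formula for the product makes sense without composability, so right
    -- translation by h is the restriction of a globally smooth map to a source fibre.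
    let R : Arrows → Arrows := fun g => ofCoords (mulCoords (coords g) (coords h))
      (mulCoords_ne_zero (coords_ne_zero g) (coords_ne_zero h))
    have hd : ContDiff ℝ ∞ fun m => mulCoords m (coords h) :=
      (contDiff_mulCoords ℝ).comp (contDiff_id.prodMk contDiff_const)
    have hR : ContMDiff 𝓘(ℝ, ChartModel) 𝓘(ℝ, ChartModel) ∞ R := by
      refine contMDiff_of_coords ?_
      simp only [R, coords_ofCoords]
      exact hd.contMDiff.comp contMDiff_coords
    have hRd := (hR.mdifferentiableAt (x := g) (by simp)).hasMFDerivAt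
    have hrm : ∀ g', ellipticGroupoid.src g' = ellipticGroupoid.tgt h →
        ellipticGroupoid.rightMul h g' = R g' := fun g' hg' => by
      simp only [LieGroupoid.rightMul, hg', dite_true]
      rfl
    have hLX : mfderiv 𝓘(ℝ, ChartModel) 𝓘(ℝ, ChartModel) R g (arrowField α g) =
        arrowField α (R g) := by
      apply dCoords_injective
      have h1 := (hasMFDerivAt_coords (R g)).comp g hRd
      have h2 := (hd.differentiable (by simp)).differentiableAt.hasFDerivAt.hasMFDerivAt.comp g
        (hasMFDerivAt_coords g)
      have h3 : coords ∘ R = (fun m => mulCoords m (coords h)) ∘ coords :=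
        funext fun g => coords_ofCoords _ _
      rw [← h3] at h2
      have h4 := DFunLike.congr_fun (hasMFDerivAt_unique h1 h2) (arrowField α g)
      refine h4.trans ?_
      rw [dCoords_arrowField]
      change fderiv ℝ (fun m => mulCoords m (coords h)) (coords g)
        (dCoords g (arrowField α g)) = _
      rw [dCoords_arrowField, fderiv_mulCoords_invariantField]
      simp [R]
    rw [hrm g hgh]
    exact ⟨_, hRd.hasMFDerivWithinAt.congr_mono hrm (hrm g hgh) subset_rfl, hLX⟩

/-- The isomorphism from the cotangent bundle to the Lie algebroid. -/
noncomputable def algebroidIso (x : ℂ × ℂ) :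
    ((ℂ × ℂ) →L[ℝ] ℝ) →ₗ[ℝ] TangentSpace 𝓘(ℝ, ChartModel) (ellipticGroupoid.one x) where
  toFun ξ := arrowField (fun _ => ξ) (ellipticGroupoid.one x)
  map_add' ξ η := by
    apply dCoords_injective
    rw [map_add]
    simp only [dCoords_arrowField, invariantField, map_add]
    refine Prod.ext ?_ (Prod.ext ?_ (funext fun k => ?_))
    · simp; ring
    · simp; ring
    · fin_cases k <;> simp <;> ring
  map_smul' r ξ := by
    apply dCoords_injective
    rw [map_smul]
    simp only [dCoords_arrowField, invariantField, map_smul]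
    refine Prod.ext ?_ (Prod.ext ?_ (funext fun k => ?_))
    · simp; ring
    · simp; ring
    · fin_cases k <;> simp <;> ring

theorem coords_one (x : ℂ × ℂ) : coords (ellipticGroupoid.one x) = oneCoords x :=
  coords_ofCoords _ (oneCoords_ne_zero x)

/-- The field at an arrow depends on the form only through its value at the target, so the constant
form used in `algebroidIso` gives the same vector. -/
theorem arrowField_one (α : ℂ × ℂ → (ℂ × ℂ) →L[ℝ] ℝ) (x : ℂ × ℂ) :
    arrowField α (ellipticGroupoid.one x) = algebroidIso x (α x) := by
  apply dCoords_injective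
  change _ = dCoords _ (arrowField (fun _ => α x) _)
  rw [dCoords_arrowField, dCoords_arrowField, coords_one]
  rfl

theorem dCoords_algebroidIso (x : ℂ × ℂ) (ξ : (ℂ × ℂ) →L[ℝ] ℝ) :
    dCoords _ (algebroidIso x ξ) =
      (-(x.1 * formC ξ), -(x.1 * formB ξ), ![formB ξ, formC ξ]) := by
  change dCoords _ (arrowField (fun _ => ξ) _) = _
  rw [dCoords_arrowField, coords_one]
  simp [invariantField, oneCoords]

/-- The real form with complex coefficients `B` and `C`. -/
noncomputable def reForm (B C : ℂ) : (ℂ × ℂ) →L[ℝ] ℝ :=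
  Complex.reCLM.comp
    ((ContinuousLinearMap.mul ℝ ℂ C).comp (ContinuousLinearMap.fst ℝ ℂ ℂ) -
      (ContinuousLinearMap.mul ℝ ℂ B).comp (ContinuousLinearMap.snd ℝ ℂ ℂ))

theorem reForm_apply (B C : ℂ) (v : ℂ × ℂ) : reForm B C v = (C * v.1 - B * v.2).re := rfl

theorem algebroidIso_injective (x : ℂ × ℂ) : Function.Injective (algebroidIso x) := by
  intro ξ η h
  have h' := congrArg (dCoords _) h
  rw [dCoords_algebroidIso, dCoords_algebroidIso] at h'
  simp only [Prod.mk.injEq] at h'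
  have hB : formB ξ = formB η := congrFun h'.2.2 0
  have hC : formC ξ = formC η := congrFun h'.2.2 1
  refine ContinuousLinearMap.ext fun v => ?_
  rw [form_eq_re, hB, hC, ← form_eq_re]

theorem range_algebroidIso (x : ℂ × ℂ) :
    Set.range (algebroidIso x) =
      {v | mfderiv 𝓘(ℝ, ChartModel) 𝓘(ℝ, ℂ × ℂ) ellipticGroupoid.src
        (ellipticGroupoid.one x) v = 0} := by
  ext v
  constructor
  · rintro ⟨ξ, rfl⟩
    change mfderiv _ _ _ _ (arrowField (fun _ => ξ) _) = 0
    rw [mfderiv_src, dCoords_arrowField, fderiv_srcCoords_invariantField]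
    rfl
  · intro hv
    change mfderiv _ _ _ _ v = 0 at hv
    rw [mfderiv_src, coords_one, fderiv_srcCoords] at hv
    set w := dCoords _ v with hw
    replace hv := hv.trans (show _ = ((0, 0) : ℂ × ℂ) from rfl)
    have h1 : w.2.1 + x.1 * w.2.2 0 = 0 := by simpa [oneCoords] using congrArg Prod.fst hv
    have h2 : x.1 * w.2.2 1 + w.1 = 0 := by simpa [oneCoords] using congrArg Prod.snd hv
    -- On the kernel of ds at a unit, the b and c components are free and determine the other two.
    -- They are the coefficients B and C of the form.
    refine ⟨reForm (w.2.2 0) (w.2.2 1), dCoords_injective _ ?_⟩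
    rw [dCoords_algebroidIso, formB_eq (reForm_apply _ _), formC_eq (reForm_apply _ _), ← hw]
    refine Prod.ext ?_ (Prod.ext ?_ (funext fun k => ?_))
    · exact (eq_neg_of_add_eq_zero_right h2).symm
    · exact (eq_neg_of_add_eq_zero_left h1).symm
    · fin_cases k <;> rfl

theorem mlieBracket_eq_lieBracket {V : Type*} [NormedAddCommGroup V] [NormedSpace ℝ V]
    (X Y : ∀ x : V, TangentSpace 𝓘(ℝ, V) x) (x : V) :
    VectorField.mlieBracket 𝓘(ℝ, V) X Y x = VectorField.lieBracket ℝ X Y x := by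
  rw [← VectorField.mlieBracketWithin_univ, VectorField.mlieBracketWithin_eq_lieBracketWithin]
  exact congrFun VectorField.lieBracketWithin_univ x

/-- Pullback along the coordinates commutes with Lie brackets, which reduces the claim to the
bracket computed on the model space. -/
theorem mlieBracket_arrowField {α β : ℂ × ℂ → (ℂ × ℂ) →L[ℝ] ℝ} (hα : ContDiff ℝ ∞ α)
    (hβ : ContDiff ℝ ∞ β) (x : ℂ × ℂ) :
    VectorField.mlieBracket 𝓘(ℝ, ChartModel) (arrowField α) (arrowField β)
      (ellipticGroupoid.one x) = algebroidIso x (koszulBracket poissonSharp α β x) := by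
  have : IsManifold 𝓘(ℝ, ChartModel) (minSmoothness ℝ 3) Arrows := by
    rw [minSmoothness_of_isRCLikeNormedField]
    exact IsManifold.of_le (n := ∞) (WithTop.coe_le_coe.2 (le_top : (3 : ℕ∞) ≤ ⊤))
  have hV := ((contMDiff_invariantField hα).mdifferentiable (by simp))
    (coords (ellipticGroupoid.one x))
  have hW := ((contMDiff_invariantField hβ).mdifferentiable (by simp))
    (coords (ellipticGroupoid.one x))
  have h := VectorField.mpullback_mlieBracket (n := ∞) hV hW
    (contMDiff_coords (𝕜 := ℝ)).contMDiffAt (by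
      rw [minSmoothness_of_isRCLikeNormedField]
      exact WithTop.coe_le_coe.2 (le_top : (2 : ℕ∞) ≤ ⊤))
  rw [← arrowField_one]
  apply dCoords_injective
  rw [dCoords_arrowField]
  refine (congrArg (dCoords _) h.symm).trans ((dCoords_inverse _ _).trans ?_)
  refine (mlieBracket_eq_lieBracket _ _ _).trans ?_
  rw [coords_one]
  exact lieBracket_invariantField hα hβ x

theorem integratesCotangent_ellipticGroupoid :
    IntegratesCotangent ellipticGroupoid poissonSharp := by
  refine ⟨algebroidIso, algebroidIso_injective, range_algebroidIso, fun α hα => ?_, fun x ξ => ?_,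
    fun α β hα hβ => ⟨arrowField α, arrowField β, isRightInvariant_arrowField hα,
      isRightInvariant_arrowField hβ, arrowField_one α, arrowField_one β,
      mlieBracket_arrowField hα hβ⟩⟩
  · simp only [← arrowField_one]
    exact (contMDiff_arrowField hα).comp ellipticGroupoid.contMDiff_one
  · rw [mfderiv_tgt, fderiv_tgtCoords, dCoords_algebroidIso, poissonSharp_apply]
    rfl

end EllipticModel

theorem mainTheorem12 :
    -- the inverse image of `(ℂ^* × ℂ)²` lies in the arrow space, where `β` is biholomorphic
    EllipticModel.blowDown ⁻¹' EllipticModel.pairArrows ⊆ EllipticModel.Arrows ∧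
    (∃ Ψ : EllipticModel.regularArrows
        ≃ₘ^∞⟮𝓘(ℂ, EllipticModel.ChartModel), 𝓘(ℂ, (ℂ × ℂ) × (ℂ × ℂ))⟯ EllipticModel.pairArrows,
      ∀ g, (Ψ g : (ℂ × ℂ) × (ℂ × ℂ)) = EllipticModel.blowDown g.1.1) ∧
    -- global holomorphic coordinates `(z, a, b, c)`, `b ≠ 0`, on the arrow space
    ∃ Φ : EllipticModel.coordDomain
        ≃ₘ^∞⟮𝓘(ℂ, ℂ × ℂ × ℂ × ℂ), 𝓘(ℂ, EllipticModel.ChartModel)⟯ EllipticModel.Arrows,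
      (∀ (z a b c : ℂ) (hb : b ≠ 0),
        EllipticModel.blowDown (Φ ⟨(z, a, b, c), hb⟩).1 = ((a, z), (a * b, a * c + z))) ∧
      -- the unique extension of the pair groupoid
      ∃ 𝒢 : EllipticModel.LieGroupoid EllipticModel.ChartModel EllipticModel.Arrows
          (ℂ × ℂ) (ℂ × ℂ),
        EllipticModel.ExtendsPairGroupoid 𝒢 ∧
        (∀ 𝒢' : EllipticModel.LieGroupoid EllipticModel.ChartModel EllipticModel.Arrows
          (ℂ × ℂ) (ℂ × ℂ), EllipticModel.ExtendsPairGroupoid 𝒢' → 𝒢' = 𝒢) ∧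
        (∀ (z a b c : ℂ) (hb : b ≠ 0),
          𝒢.src (Φ ⟨(z, a, b, c), hb⟩) = (a * b, a * c + z) ∧
          𝒢.tgt (Φ ⟨(z, a, b, c), hb⟩) = (a, z)) ∧
        EllipticModel.IntegratesCotangent 𝒢 EllipticModel.poissonSharp := by
  have hcoords : ∀ (z a b c : ℂ) (hb : b ≠ 0),
      EllipticModel.coords (EllipticModel.coordDiffeomorph ⟨(z, a, b, c), hb⟩) =
        (z, a, ![b, c]) := fun z a b c hb =>
    EllipticModel.coords_ofCoords _ (EllipticModel.toModel_ne_zero (m := (z, a, b, c)) hb)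
  refine ⟨EllipticModel.preimage_pairArrows_subset, ⟨EllipticModel.regularDiffeomorph,
    fun g => rfl⟩, EllipticModel.coordDiffeomorph, fun z a b c hb => ?_,
    EllipticModel.ellipticGroupoid, EllipticModel.extendsPairGroupoid_ellipticGroupoid,
    EllipticModel.eq_ellipticGroupoid, fun z a b c hb => ?_,
    EllipticModel.integratesCotangent_ellipticGroupoid⟩
  · rw [EllipticModel.blowDown_coords, hcoords]
    rfl
  · change EllipticModel.srcCoords (EllipticModel.coords _) = _ ∧
      EllipticModel.tgtCoords (EllipticModel.coords _) = _
    rw [hcoords]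
    exact ⟨rfl, rfl⟩
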